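/- Let $P$ be a bounded $n$-dimensional convex polytope in hyperbolic space $\mathbb H^n$ which is right-angled, i.e. any two distinct facets that meet are orthogonal. For a facet $F$ of $P$ let $s_F$ be the reflection of $\mathbb H^n$ across the hyperplane spanned by $F$, and let $W$ be the group generated by all $s_F$. A characteristic function is an epimorphism $\lambda : W \to (\mathbb Z/2)^n$ such that, whenever $n$ distinct facets $F_1,\dots,F_n$ have a common vertex, $\lambda(s_{F_1}),\dots,\lambda(s_{F_n})$ is a basis of $(\mathbb Z/2)^n$. The small cover associated with $\lambda$ is $M_\lambda = \mathbb H^n/\ker\lambda$, with the cell structure whose closed cells are the images of the faces of the tiles $wP$, $w\in W$ ($P$ counts as a face of itself). A symmetry $a$ of $P$ acts on $W$ by the automorphism $s_F\mapsto s_{a(F)}$. For a group $A$ of symmetries of $P$, call $M_\lambda$ and $M_\mu$ equivalent (with respect to $A$) if $\lambda = g\circ\mu\circ a$ for some $a\in A$ and $g\in GL_n(\mathbb Z/2)$. An isomorphism of cell complexes $M_\lambda\to M_\mu$ is a homeomorphism $\varphi$ such that a set $D\subset M_\lambda$ is a closed cell if and only if $\varphi(D)$ is; it is geometric if moreover it is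 isometric on every cell, i.e. on every tile $wP$ it is induced by an isometry of $\mathbb H^n$. **Proposition 2.4.** Let $M_\lambda$ and $M_\mu$ be two small covers of $P$. 1. $M_\lambda$ and $M_\mu$ are equivalent with respect to the group of combinatorial symmetries of $P$ (automorphisms of its face poset) if and only if they are isomorphic as cell complexes. 2. $M_\lambda$ and $M_\mu$ are equivalent with respect to the group of isometric symmetries of $P$ (isometries of $\mathbb H^n$ preserving $P$) if and only if they are isomorphic as geometric cell complexes. -/

import Mathlib

noncomputable section

/-- The vector space `ℝ^{n,1}`, written as (time coordinate, space coordinates). -/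
abbrev LVec (n : ℕ) : Type := ℝ × EuclideanSpace ℝ (Fin n)

/-- The Lorentz form of signature `(n, 1)`. -/
def lor {n : ℕ} (x y : LVec n) : ℝ := inner ℝ x.2 y.2 - x.1 * y.1

/-- Hyperbolic `n`-space, in the hyperboloid model, with the subspace topology. -/
abbrev Hyp (n : ℕ) : Type := {x : LVec n // lor x x = -1 ∧ 0 < x.1}

/-- The hyperbolic distance: `cosh d(x, y) = -⟨x, y⟩`. -/
def hdist {n : ℕ} (x y : Hyp n) : ℝ := Real.arcosh (-lor x.1 y.1)

/-- Isometries of hyperbolic space: distance-preserving bijections. -/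
def IsHypIsometry {n : ℕ} (h : Equiv.Perm (Hyp n)) : Prop :=
  ∀ x y, hdist (h x) (h y) = hdist x y

/-- The Lorentz reflection of the vector space in the hyperplane orthogonal to `u`. -/
def lorReflect {n : ℕ} (u x : LVec n) : LVec n := x - (2 * lor x u) • u

theorem lor_lorReflect {n : ℕ} {u : LVec n} (hu : lor u u = 1) (x : LVec n) :
    lor (lorReflect u x) (lorReflect u x) = lor x x := by
  simp only [lor, lorReflect, Prod.fst_sub, Prod.snd_sub, Prod.smul_fst, Prod.smul_snd,
    inner_sub_left, inner_sub_right, inner_smul_left, inner_smul_right, smul_eq_mul,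
    real_inner_comm x.2 u.2] at *
  simp only [conj_trivial]
  linear_combination 4 * (inner ℝ x.2 u.2 - x.1 * u.1) ^ 2 * hu

theorem lorReflect_lorReflect {n : ℕ} {u : LVec n} (hu : lor u u = 1) (x : LVec n) :
    lorReflect u (lorReflect u x) = x := by
  have h : lor (lorReflect u x) u = -lor x u := by
    simp only [lor, lorReflect, Prod.fst_sub, Prod.snd_sub, Prod.smul_fst, Prod.smul_snd,
      inner_sub_left, inner_smul_left, smul_eq_mul, conj_trivial] at *
    linear_combination -2 * (inner ℝ x.2 u.2 - x.1 * u.1) * hu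
  rw [lorReflect, h, lorReflect]
  module

theorem lorReflect_mem {n : ℕ} {u : LVec n} (hu : lor u u = 1) {x : LVec n}
    (hx : lor x x = -1 ∧ 0 < x.1) :
    lor (lorReflect u x) (lorReflect u x) = -1 ∧ 0 < (lorReflect u x).1 := by
  have h1 : lor (lorReflect u x) (lorReflect u x) = -1 := by rw [lor_lorReflect hu, hx.1]
  refine ⟨h1, ?_⟩
  have h2 : lor x (lorReflect u x) = -1 - 2 * lor x u ^ 2 := by
    have := hx.1
    simp only [lor, lorReflect, Prod.fst_sub, Prod.snd_sub, Prod.smul_fst, Prod.smul_snd,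
      inner_sub_right, inner_smul_right, smul_eq_mul] at *
    linear_combination this
  generalize lorReflect u x = y at *
  by_contra hy
  have hx1 := hx.1
  simp only [lor, real_inner_self_eq_norm_sq] at hx1 h1 h2
  have hx0 := hx.2
  have hc := neg_le_of_abs_le (abs_real_inner_le_norm x.2 y.2)
  have ha : ‖x.2‖ ≤ x.1 := by
    apply le_of_sq_le_sq _ hx0.le
    nlinarith
  have hb : ‖y.2‖ ≤ -y.1 := by
    apply le_of_sq_le_sq _ (by linarith)
    nlinarith
  have hm := mul_le_mul ha hb (norm_nonneg _) hx0.le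
  nlinarith [sq_nonneg (inner ℝ x.2 u.2 - x.1 * u.1)]

/-- The reflection of hyperbolic space across the hyperplane with unit normal `u`. -/
def hypReflection {n : ℕ} (u : LVec n) (hu : lor u u = 1) : Equiv.Perm (Hyp n) where
  toFun x := ⟨lorReflect u x.1, lorReflect_mem hu x.2⟩
  invFun x := ⟨lorReflect u x.1, lorReflect_mem hu x.2⟩
  left_inv x := Subtype.ext (lorReflect_lorReflect hu x.1)
  right_inv x := Subtype.ext (lorReflect_lorReflect hu x.1)

/-- A bounded `n`-dimensional right-angled convex polytope in `ℍⁿ`, given as the irredundant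
intersection of finitely many closed half-spaces `⟨x, u i⟩ ≤ 0` with unit outward normals `u i`;
the index type `ι` labels its facets. -/
structure RAPolytope (n : ℕ) (ι : Type*) where
  finite_facets : Finite ι
  /-- the outward unit normals of the facets -/
  normal : ι → LVec n
  unit : ∀ i, lor (normal i) (normal i) = 1
  /-- the polytope has non-empty interior -/
  solid : ∃ x : Hyp n, ∀ i, lor x.1 (normal i) < 0
  bounded : IsCompact {x : Hyp n | ∀ i, lor x.1 (normal i) ≤ 0}
  /-- every half-space contributes a codimension-one face, and different ones different faces -/
  irredundant : ∀ i, ∃ x : Hyp n, lor x.1 (normal i) = 0 ∧ ∀ j, j ≠ i → lor x.1 (normal j) < 0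
  /-- two facets that meet are orthogonal -/
  right_angled : ∀ i j, i ≠ j →
    (∃ x : Hyp n, (∀ k, lor x.1 (normal k) ≤ 0) ∧ lor x.1 (normal i) = 0 ∧
      lor x.1 (normal j) = 0) →
    lor (normal i) (normal j) = 0

namespace RAPolytope

variable {n : ℕ} {ι : Type*} (P : RAPolytope n ι)

/-- The polytope as a set of points. -/
def body : Set (Hyp n) := {x | ∀ i, lor x.1 (P.normal i) ≤ 0}

/-- The facet with label `i`. -/
def facet (i : ι) : Set (Hyp n) := {x | x ∈ P.body ∧ lor x.1 (P.normal i) = 0}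

/-- The non-empty faces of the polytope: the polytope itself and the non-empty intersections of
facets. -/
def IsFace (C : Set (Hyp n)) : Prop :=
  C.Nonempty ∧ ∃ S : Set ι, C = {x | x ∈ P.body ∧ ∀ i ∈ S, x ∈ P.facet i}

/-- The poset of non-empty faces, ordered by inclusion. -/
abbrev Face : Type := {C : Set (Hyp n) // P.IsFace C}

/-- The reflection across the facet with label `i`. -/
def s (i : ι) : Equiv.Perm (Hyp n) := hypReflection (P.normal i) (P.unit i)

/-- The group generated by the reflections across the facets. -/
def W : Subgroup (Equiv.Perm (Hyp n)) := Subgroup.closure (Set.range P.s)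

/-- The reflection across the facet with label `i`, as an element of `W`. -/
def gen (i : ι) : P.W := ⟨P.s i, Subgroup.subset_closure ⟨i, rfl⟩⟩

/-- The combinatorial symmetries of the polytope (automorphisms of its face poset), recorded by
the permutations of the facets that they induce. -/
def combSymmetries : Set (Equiv.Perm ι) :=
  {σ | ∃ a : P.Face ≃o P.Face, ∀ (i : ι) (C : P.Face), C.1 = P.facet i → (a C).1 = P.facet (σ i)}

/-- The isometric symmetries of the polytope (isometries of `ℍⁿ` that map it onto itself),
recorded by the permutations of the facets that they induce. -/
def isomSymmetries : Set (Equiv.Perm ι) :=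
  {σ | ∃ h : Equiv.Perm (Hyp n), IsHypIsometry h ∧ h '' P.body = P.body ∧
    ∀ i, h '' P.facet i = P.facet (σ i)}

/-- A characteristic function: an epimorphism `W → (ℤ/2)ⁿ` that sends the reflections across any
`n` different facets with a common vertex to a basis. -/
structure CharFn where
  hom : P.W →* Multiplicative (Fin n → ZMod 2)
  surj : Function.Surjective hom
  basis : ∀ f : Fin n ↪ ι, (∃ v : Hyp n, ∀ k, v ∈ P.facet (f k)) →
    LinearIndependent (ZMod 2) (fun k => (hom (P.gen (f k))).toAdd) ∧
    Submodule.span (ZMod 2) (Set.range fun k => (hom (P.gen (f k))).toAdd) = ⊤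

namespace CharFn

variable {P}

/-- The small cover `ℍⁿ / ker l`, with the quotient topology. -/
abbrev SmallCover (l : P.CharFn) : Type := Quotient (MulAction.orbitRel l.hom.ker (Hyp n))

/-- The covering projection from `ℍⁿ`. -/
def proj (l : P.CharFn) (x : Hyp n) : l.SmallCover := Quotient.mk _ x

/-- The closed cells of the small cover: the images of the faces of the tiles `w P`, `w ∈ W`. -/
def cells (l : P.CharFn) : Set (Set l.SmallCover) :=
  {D | ∃ w ∈ P.W, ∃ C, P.IsFace C ∧ D = l.proj '' (w '' C)}

/-- Equivalence of small covers with respect to a set `A` of symmetries of the polytope: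
`l = g ∘ m ∘ a` with `a ∈ A` acting on `W` by `s_F ↦ s_{a(F)}` and `g ∈ GL_n(ℤ/2)`. -/
def EquivalentVia (A : Set (Equiv.Perm ι)) (l m : P.CharFn) : Prop :=
  ∃ σ ∈ A, ∃ a : P.W ≃* P.W, (∀ i, a (P.gen i) = P.gen (σ i)) ∧
    ∃ g : Matrix.GeneralLinearGroup (Fin n) (ZMod 2),
      ∀ w, (l.hom w).toAdd = g.1.mulVec (m.hom (a w)).toAdd

/-- A homeomorphism of small covers that maps cells onto cells, in both directions. -/
def IsCellIso {l m : P.CharFn} (φ : l.SmallCover ≃ₜ m.SmallCover) : Prop :=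
  ∀ D : Set l.SmallCover, D ∈ l.cells ↔ φ '' D ∈ m.cells

/-- The map of small covers is an isometry on each maximal cell (hence on each cell): on each tile
it is induced by an isometry of `ℍⁿ`. -/
def IsCellwiseIsometric {l m : P.CharFn} (φ : l.SmallCover ≃ₜ m.SmallCover) : Prop :=
  ∀ w ∈ P.W, ∃ h : Equiv.Perm (Hyp n), IsHypIsometry h ∧
    ∀ x ∈ w '' P.body, φ (l.proj x) = m.proj (h x)

end CharFn

end RAPolytope

end

/-! Because `P` is right-angled, `W` is the abstract right-angled Coxeter group on its facets
(`toW_injective`), and `P` is a strict fundamental domain whose point stabilizers are generated by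
the reflections across the facets through the point (`eq_of_smul_mem_body`, `exists_smul_mem_body`).
Hence a facet permutation that preserves incidence extends to an automorphism `a` of `W`, and a
homeomorphism of `P` that permutes the facets in the same way extends `a`-equivariantly to
hyperbolic space. If `a` carries the kernel of `l` onto that of `m`, the extension descends to the
small covers (`exists_cellIso`). An isometric symmetry supplies its own homeomorphism of `P`; a
combinatorial one acts on the barycentric subdivision of `P`, that is, on the order complex of the
face poset (`exists_homeomorph`).

Conversely, a cellular homeomorphism permutes the maximal cells, which are the tiles, and induces an
automorphism of the face poset on each. The automorphisms of adjacent tiles agree on the common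
facet, and an automorphism that fixes all faces of one facet fixes every facet:
`automorphism_rigid`, proved by walking along the connected edge graph. So one permutation `σ`
serves all tiles. Following tiles across facets, the tile of `w` goes to the tile of `θ 1 * a w`
modulo the kernel, so `a` matches the kernels (`IsCellIso.exists_symmetry`). Matching kernels amount
to the existence of `g` (`exists_generalLinear_of_ker_eq`), which gives the combinatorial statement.
In the geometric case the isometry on one tile, corrected by an element of `W`, preserves `P` and
induces the same `σ`. -/

open Filter Topology

/-! ### Lorentz geometry of the hyperboloid model. -/

section Lorentz

variable {n : ℕ}

theorem lor_comm (x y : LVec n) : lor x y = lor y x := by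
  simp only [lor, real_inner_comm, mul_comm]

theorem lor_add_left (x y z : LVec n) : lor (x + y) z = lor x z + lor y z := by
  simp only [lor, Prod.fst_add, Prod.snd_add, inner_add_left]; ring

theorem lor_smul_left (c : ℝ) (x y : LVec n) : lor (c • x) y = c * lor x y := by
  simp only [lor, Prod.smul_fst, Prod.smul_snd, inner_smul_left, smul_eq_mul, conj_trivial]; ring

theorem lor_add_right (x y z : LVec n) : lor x (y + z) = lor x y + lor x z := by
  rw [lor_comm, lor_add_left, lor_comm y, lor_comm z]

theorem lor_smul_right (c : ℝ) (x y : LVec n) : lor x (c • y) = c * lor x y := by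
  rw [lor_comm, lor_smul_left, lor_comm y]

theorem lor_neg_left (x y : LVec n) : lor (-x) y = -lor x y := by
  rw [← neg_one_smul ℝ, lor_smul_left]; ring

theorem lor_neg_right (x y : LVec n) : lor x (-y) = -lor x y := by
  rw [lor_comm, lor_neg_left, lor_comm y]

theorem lor_sub_left (x y z : LVec n) : lor (x - y) z = lor x z - lor y z := by
  rw [sub_eq_add_neg, lor_add_left, lor_neg_left]; ring

theorem lor_sub_right (x y z : LVec n) : lor x (y - z) = lor x y - lor x z := by
  rw [lor_comm, lor_sub_left, lor_comm y, lor_comm z]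

theorem lor_zero_left (x : LVec n) : lor 0 x = 0 := by simp [lor]

/-- The Lorentz form as a linear functional of its first argument. -/
noncomputable def lorLin (y : LVec n) : LVec n →ₗ[ℝ] ℝ where
  toFun x := lor x y
  map_add' a b := lor_add_left a b y
  map_smul' c a := lor_smul_left c a y

theorem lor_sum_left {α : Type*} (s : Finset α) (f : α → LVec n) (y : LVec n) :
    lor (∑ a ∈ s, f a) y = ∑ a ∈ s, lor (f a) y :=
  map_sum (lorLin y) f s

theorem lor_sum_right {α : Type*} (s : Finset α) (f : α → LVec n) (y : LVec n) :
    lor y (∑ a ∈ s, f a) = ∑ a ∈ s, lor y (f a) := by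
  simp only [lor_comm y, lor_sum_left]

@[fun_prop]
theorem Continuous.lor {X : Type*} [TopologicalSpace X] {f g : X → LVec n} (hf : Continuous f)
    (hg : Continuous g) : Continuous fun x => _root_.lor (f x) (g x) := by
  unfold _root_.lor
  fun_prop

theorem Hyp.lor_self (x : Hyp n) : lor x.1 x.1 = -1 := x.2.1

theorem Hyp.norm_sq (x : Hyp n) : ‖x.1.2‖ ^ 2 = x.1.1 ^ 2 - 1 := by
  have := x.2.1
  simp only [lor, real_inner_self_eq_norm_sq] at this
  linarith

theorem norm_lt_of_lor_neg {v : LVec n} (h : lor v v < 0) (h0 : 0 < v.1) : ‖v.2‖ < v.1 := by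
  simp only [lor, real_inner_self_eq_norm_sq] at h
  exact lt_of_pow_lt_pow_left₀ 2 h0.le (by linarith)

theorem norm_le_of_lor_nonpos {v : LVec n} (h : lor v v ≤ 0) (h0 : 0 ≤ v.1) : ‖v.2‖ ≤ v.1 := by
  simp only [lor, real_inner_self_eq_norm_sq] at h
  exact le_of_sq_le_sq (by linarith) h0

theorem lor_neg_of_norm_lt {v : LVec n} (h : ‖v.2‖ < v.1) : lor v v < 0 := by
  simp only [lor, real_inner_self_eq_norm_sq]
  nlinarith [norm_nonneg v.2]

/-- Vectors orthogonal to a point of hyperbolic space are spacelike. -/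
theorem norm_sq_le_of_orthogonal (x : Hyp n) {v : LVec n} (h : lor v x.1 = 0) :
    ‖v.2‖ ^ 2 ≤ x.1.1 ^ 2 * lor v v := by
  have hx := x.norm_sq
  have hc := abs_real_inner_le_norm v.2 x.1.2
  simp only [lor] at h
  have h1 : inner ℝ v.2 x.1.2 ^ 2 ≤ (‖v.2‖ * ‖x.1.2‖) ^ 2 := sq_le_sq' (by
    linarith [neg_le_of_abs_le hc]) (le_of_abs_le hc)
  rw [sub_eq_zero.1 h, mul_pow, mul_pow, hx] at h1
  simp only [lor, real_inner_self_eq_norm_sq]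
  nlinarith

theorem fst_sq_le_of_orthogonal (x : Hyp n) {v : LVec n} (h : lor v x.1 = 0) :
    v.1 ^ 2 ≤ x.1.1 ^ 2 * lor v v := by
  have h1 := norm_sq_le_of_orthogonal x h
  have hx := x.norm_sq
  have h2 : 0 ≤ lor v v := by
    have := sq_nonneg ‖v.2‖
    by_contra hn
    have := mul_neg_of_pos_of_neg (pow_pos x.2.2 2) (not_le.1 hn)
    linarith
  have h3 : v.1 ^ 2 = ‖v.2‖ ^ 2 - lor v v := by
    simp only [lor, real_inner_self_eq_norm_sq]; ring
  linarith

theorem lor_self_nonneg_of_orthogonal (x : Hyp n) {v : LVec n} (h : lor v x.1 = 0) :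
    0 ≤ lor v v := by
  have := norm_sq_le_of_orthogonal x h
  by_contra hn
  have := mul_neg_of_pos_of_neg (pow_pos x.2.2 2) (not_le.1 hn)
  linarith [sq_nonneg ‖v.2‖]

theorem eq_zero_of_orthogonal (x : Hyp n) {v : LVec n} (h : lor v x.1 = 0) (hv : lor v v ≤ 0) :
    v = 0 := by
  have h0 := le_antisymm hv (lor_self_nonneg_of_orthogonal x h)
  have h1 := norm_sq_le_of_orthogonal x h
  have h2 := fst_sq_le_of_orthogonal x h
  rw [h0, mul_zero] at h1 h2
  refine Prod.ext ?_ ?_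
  · exact pow_eq_zero_iff two_ne_zero |>.1 (le_antisymm h2 (sq_nonneg _))
  · exact norm_eq_zero.1 (pow_eq_zero_iff two_ne_zero |>.1 (le_antisymm h1 (sq_nonneg _)))

theorem lor_neg_of_future {v w : LVec n} (hv : ‖v.2‖ ≤ v.1) (hv0 : 0 < v.1) (hw : ‖w.2‖ < w.1) :
    lor v w < 0 := by
  have := le_of_abs_le (abs_real_inner_le_norm v.2 w.2)
  simp only [lor]
  nlinarith [norm_nonneg v.2, norm_nonneg w.2]

theorem Hyp.norm_lt (x : Hyp n) : ‖x.1.2‖ < x.1.1 :=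
  norm_lt_of_lor_neg (by rw [x.lor_self]; norm_num) x.2.2

theorem Hyp.lor_neg (x y : Hyp n) : lor x.1 y.1 < 0 :=
  lor_neg_of_future x.norm_lt.le x.2.2 y.norm_lt

/-- A vector in the closed solid light cone with negative product with a point is future. -/
theorem fst_pos_of_lor_neg (x : Hyp n) {v : LVec n} (h : lor v v ≤ 0) (hx : lor v x.1 < 0) :
    0 < v.1 := by
  by_contra hn
  have hn := not_lt.1 hn
  have h1 : ‖(-v).2‖ ≤ (-v).1 := by
    apply norm_le_of_lor_nonpos
    · rw [lor_neg_left, lor_neg_right]; linarith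
    · simpa using hn
  rcases hn.eq_or_lt with h0 | h0
  · have hv : v = 0 := by
      refine Prod.ext h0 ?_
      simpa [h0] using h1
    rw [hv, lor_zero_left] at hx
    exact lt_irrefl _ hx
  · have := lor_neg_of_future h1 (by simpa using h0) x.norm_lt
    rw [lor_neg_left] at this
    linarith

/-- The vector `y + ⟨x, y⟩ x` is the component of `y` orthogonal to `x`; it is spacelike and
measures how far `y` is from `x`. -/
theorem lor_self_perp (x y : Hyp n) :
    lor (y.1 + lor x.1 y.1 • x.1) x.1 = 0 := by
  rw [lor_add_left, lor_smul_left, x.lor_self, lor_comm]; ring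

theorem lor_perp_self (x y : Hyp n) :
    lor (y.1 + lor x.1 y.1 • x.1) (y.1 + lor x.1 y.1 • x.1) = lor x.1 y.1 ^ 2 - 1 := by
  rw [lor_add_right, lor_smul_right, lor_self_perp, lor_add_left, lor_smul_left, y.lor_self]; ring

/-- Reversed Cauchy–Schwarz: the component of `y` orthogonal to `x` has nonnegative square `⟨x, y⟩²
- 1`. -/
theorem Hyp.lor_le (x y : Hyp n) : lor x.1 y.1 ≤ -1 := by
  have h := lor_self_nonneg_of_orthogonal x (lor_self_perp x y)
  rw [lor_perp_self] at h
  nlinarith [Hyp.lor_neg x y]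

/-- Convergence in hyperbolic space is detected by the Lorentz form. -/
theorem Hyp.tendsto_of_lor {α : Type*} {l : Filter α} {x : Hyp n} {y : α → Hyp n}
    (h : Tendsto (fun a => lor x.1 (y a).1) l (𝓝 (-1))) : Tendsto y l (𝓝 x) := by
  rw [tendsto_subtype_rng]
  set v : α → LVec n := fun a => (y a).1 + lor x.1 (y a).1 • x.1 with hv
  -- Both coordinates of the orthogonal component `v` are bounded by this square root.
  have hz : Tendsto (fun a => √(x.1.1 ^ 2 * (lor x.1 (y a).1 ^ 2 - 1))) l (𝓝 0) := by
    have := ((((h.pow 2).sub_const 1).const_mul (x.1.1 ^ 2))).sqrt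
    simpa using this
  have h1 : Tendsto (fun a => (v a).1) l (𝓝 0) := by
    refine squeeze_zero_norm (fun a => ?_) hz
    apply Real.le_sqrt_of_sq_le
    rw [Real.norm_eq_abs, sq_abs, ← lor_perp_self]
    exact fst_sq_le_of_orthogonal x (lor_self_perp x (y a))
  have h2 : Tendsto (fun a => (v a).2) l (𝓝 0) := by
    refine squeeze_zero_norm (fun a => ?_) hz
    apply Real.le_sqrt_of_sq_le
    rw [← lor_perp_self]
    exact norm_sq_le_of_orthogonal x (lor_self_perp x (y a))
  have h3 : Tendsto v l (𝓝 0) := h1.prodMk_nhds h2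
  have h4 := h3.sub (h.smul_const x.1)
  simpa [hv] using h4

/-- Closed balls are compact: `z.1 * (x.1 - ‖x.2‖) ≤ -⟨z, x⟩` bounds the time coordinate, which
bounds the space coordinate. -/
theorem Hyp.isCompact_sublevel (x : Hyp n) (D : ℝ) : IsCompact {z : Hyp n | -lor z.1 x.1 ≤ D} := by
  rw [Subtype.isCompact_iff]
  have hx : 0 < x.1.1 - ‖x.1.2‖ := sub_pos.2 x.norm_lt
  apply Metric.isCompact_of_isClosed_isBounded
  · have : (Subtype.val '' {z : Hyp n | -lor z.1 x.1 ≤ D}) =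
        {z : LVec n | lor z z = -1} ∩ {z | 0 ≤ z.1} ∩ {z | -lor z x.1 ≤ D} := by
      ext z
      constructor
      · rintro ⟨z, hz, rfl⟩
        exact ⟨⟨z.2.1, z.2.2.le⟩, hz⟩
      · rintro ⟨⟨h1, h2⟩, h3⟩
        -- The closed condition `0 ≤ z.1` suffices, because a vector with time coordinate zero has
        -- nonnegative square.
        refine ⟨⟨z, h1, lt_of_le_of_ne h2 fun h => ?_⟩, h3, rfl⟩
        simp only [Set.mem_ofPred_eq, lor, ← h, mul_zero, sub_zero] at h1
        linarith [real_inner_self_nonneg (x := z.2)]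
    rw [this]
    refine ((isClosed_eq ?_ ?_).inter (isClosed_le ?_ ?_)).inter (isClosed_le ?_ ?_) <;> fun_prop
  · refine Bornology.IsBounded.subset
      (Metric.isBounded_closedBall (x := (0 : LVec n)) (r := D / (x.1.1 - ‖x.1.2‖))) ?_
    rintro _ ⟨z, hz, rfl⟩
    have hz : -lor z.1 x.1 ≤ D := hz
    have h1 : z.1.1 * (x.1.1 - ‖x.1.2‖) ≤ D := by
      refine le_trans ?_ hz
      have := le_of_abs_le (abs_real_inner_le_norm z.1.2 x.1.2)
      simp only [lor]
      nlinarith [Hyp.norm_lt z, norm_nonneg x.1.2]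
    have h2 := (le_div_iff₀ hx).2 h1
    rw [mem_closedBall_zero_iff, Prod.norm_def]
    refine max_le ?_ ((Hyp.norm_lt z).le.trans h2)
    rwa [Real.norm_of_nonneg z.2.2.le]

theorem IsHypIsometry.lor_eq {h : Equiv.Perm (Hyp n)} (hh : IsHypIsometry h) (x y : Hyp n) :
    lor (h x).1 (h y).1 = lor x.1 y.1 := by
  have := Real.arcosh_injOn (by simpa using le_neg.1 ((h x).lor_le (h y)))
    (by simpa using le_neg.1 (x.lor_le y)) (hh x y)
  linarith

theorem isHypIsometry_of_lor {h : Equiv.Perm (Hyp n)}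
    (hh : ∀ x y, lor (h x).1 (h y).1 = lor x.1 y.1) : IsHypIsometry h := fun x y => by
  rw [hdist, hdist, hh]

theorem IsHypIsometry.continuous {h : Equiv.Perm (Hyp n)} (hh : IsHypIsometry h) :
    Continuous h := by
  rw [continuous_iff_continuousAt]
  intro x
  apply Hyp.tendsto_of_lor
  simp only [hh.lor_eq]
  have : Continuous fun y : Hyp n => lor x.1 y.1 := by fun_prop
  simpa [x.lor_self] using this.tendsto x

theorem IsHypIsometry.symm {h : Equiv.Perm (Hyp n)} (hh : IsHypIsometry h) :
    IsHypIsometry h⁻¹ := fun x y => by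
  rw [← hh]
  simp

theorem IsHypIsometry.mul {h k : Equiv.Perm (Hyp n)} (hh : IsHypIsometry h)
    (hk : IsHypIsometry k) : IsHypIsometry (h * k) := fun x y => by
  rw [Equiv.Perm.mul_apply, Equiv.Perm.mul_apply, hh, hk]

/-- The point of hyperbolic space on the ray of a future timelike vector. -/
noncomputable def hypNormalize (v : LVec n) (h : lor v v < 0) (h0 : 0 < v.1) : Hyp n :=
  ⟨(√(-lor v v))⁻¹ • v, by
    have hs : 0 < √(-lor v v) := Real.sqrt_pos.2 (by linarith)
    constructor
    · rw [lor_smul_left, lor_smul_right, ← mul_assoc, ← mul_inv, Real.mul_self_sqrt (by linarith)]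
      have : lor v v ≠ 0 := h.ne
      field_simp
    · exact mul_pos (inv_pos.2 hs) h0⟩

theorem hypNormalize_eq (v : LVec n) (h : lor v v < 0) (h0 : 0 < v.1) :
    ∃ c : ℝ, 0 < c ∧ (hypNormalize v h h0).1 = c • v :=
  ⟨_, inv_pos.2 (Real.sqrt_pos.2 (by linarith)), rfl⟩

theorem Hyp.eq_of_smul_eq {x y : Hyp n} {c : ℝ} (h : x.1 = c • y.1) : x = y := by
  have h1 := x.lor_self
  rw [h, lor_smul_left, lor_smul_right, y.lor_self] at h1
  have h2 : 0 < c := by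
    have := x.2.2
    rw [h] at this
    exact pos_of_mul_pos_left this y.2.2.le
  have : c = 1 := by nlinarith
  exact Subtype.ext (by rw [h, this, one_smul])

theorem convex_future : Convex ℝ {v : LVec n | ‖v.2‖ < v.1} := by
  intro v hv w hw a b ha hb hab
  simp only [Set.mem_ofPred_eq, Prod.fst_add, Prod.snd_add, Prod.smul_fst, Prod.smul_snd,
    smul_eq_mul] at *
  calc ‖a • v.2 + b • w.2‖ ≤ ‖a • v.2‖ + ‖b • w.2‖ := norm_add_le _ _
    _ = a * ‖v.2‖ + b * ‖w.2‖ := by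
      rw [norm_smul, norm_smul, Real.norm_of_nonneg ha, Real.norm_of_nonneg hb]
    _ < a * v.1 + b * w.1 := by
      rcases ha.eq_or_lt with h | h
      · subst h
        have : b = 1 := by linarith
        subst this; simpa using hw
      · have := mul_lt_mul_of_pos_left hv h
        have := mul_le_mul_of_nonneg_left hw.le hb
        linarith

/-- A nonzero nonnegative combination of points of hyperbolic space is future timelike. -/
theorem norm_lt_sum_smul {α : Type*} (s : Finset α) (t : α → ℝ) (b : α → Hyp n)
    (ht : ∀ a ∈ s, 0 ≤ t a) (hpos : 0 < ∑ a ∈ s, t a) :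
    ‖(∑ a ∈ s, t a • (b a).1).2‖ < (∑ a ∈ s, t a • (b a).1).1 := by
  have := convex_future.centerMass_mem (t := s) (z := fun a => (b a).1) ht hpos
    (fun a _ => (b a).norm_lt)
  rw [Finset.centerMass, Set.mem_ofPred_eq, Prod.smul_snd, Prod.smul_fst, norm_smul, smul_eq_mul,
    Real.norm_of_nonneg (inv_nonneg.2 hpos.le)] at this
  exact lt_of_mul_lt_mul_left this (inv_nonneg.2 hpos.le)

theorem hypReflection_lor {u : LVec n} (hu : lor u u = 1) (x y : Hyp n) :
    lor (hypReflection u hu x).1 (hypReflection u hu y).1 = lor x.1 y.1 := by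
  change lor (lorReflect u x.1) (lorReflect u y.1) = _
  simp only [lorReflect, lor_sub_left, lor_sub_right, lor_smul_left, lor_smul_right, hu,
    lor_comm u]
  ring

end Lorentz

/-! ### Walls of a right-angled polytope and its reflection group as a Coxeter group. -/

namespace RAPolytope

variable {n : ℕ} {ι : Type*} (P : RAPolytope n ι)

theorem isCompact_body : IsCompact P.body := P.bounded

theorem isClosed_facet (i : ι) : IsClosed {x : Hyp n | lor x.1 (P.normal i) = 0} :=
  isClosed_eq (by fun_prop) continuous_const

theorem isCompact_facet (i : ι) : IsCompact (P.facet i) :=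
  P.isCompact_body.inter_right (P.isClosed_facet i)

theorem facet_nonempty (i : ι) : (P.facet i).Nonempty := by
  obtain ⟨x, hx, h⟩ := P.irredundant i
  refine ⟨x, fun j => ?_, hx⟩
  by_cases hj : j = i
  · rw [hj, hx]
  · exact (h j hj).le

/-- Two facets have a common point. -/
def Meets (i j : ι) : Prop := ∃ x, x ∈ P.facet i ∧ x ∈ P.facet j

theorem Meets.symm {P : RAPolytope n ι} {i j : ι} (h : P.Meets i j) : P.Meets j i :=
  let ⟨x, hi, hj⟩ := h
  ⟨x, hj, hi⟩

theorem Meets.orthogonal {P : RAPolytope n ι} {i j : ι} (h : P.Meets i j) (hij : i ≠ j) :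
    lor (P.normal i) (P.normal j) = 0 :=
  let ⟨x, hi, hj⟩ := h
  P.right_angled i j hij ⟨x, hi.1, hi.2, hj.2⟩

theorem eventually_future (y : Hyp n) (v : LVec n) :
    ∀ᶠ t : ℝ in 𝓝 0, ‖(y.1 + t • v).2‖ < (y.1 + t • v).1 := by
  have h : Continuous fun t : ℝ => (y.1 + t • v).1 - ‖(y.1 + t • v).2‖ := by fun_prop
  have := h.tendsto 0
  simp only [zero_smul, add_zero] at this
  filter_upwards [this.eventually_const_lt (sub_pos.2 y.norm_lt)] with t ht
  exact sub_pos.1 ht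

theorem eventually_lor_neg (y : Hyp n) (v : LVec n) :
    ∀ᶠ t : ℝ in 𝓝 0, ∀ k, lor y.1 (P.normal k) < 0 → lor (y.1 + t • v) (P.normal k) < 0 := by
  have := P.finite_facets
  rw [eventually_all]
  intro k
  by_cases hk : lor y.1 (P.normal k) < 0
  · have h : Continuous fun t : ℝ => lor (y.1 + t • v) (P.normal k) := by fun_prop
    have := h.tendsto 0
    simp only [zero_smul, add_zero] at this
    filter_upwards [this.eventually_lt_const hk] with t ht _ using ht
  · exact Eventually.of_forall fun t h => absurd h hk

/-- The foot of the perpendicular from a point of the polytope to a facet hyperplane lies in the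
facet. -/
theorem exists_foot {x : Hyp n} (hx : x ∈ P.body) (i : ι) :
    ∃ y ∈ P.facet i, x.1 = (-lor x.1 y.1) • y.1 + lor x.1 (P.normal i) • P.normal i := by
  -- Since `⟨y, x⟩` is minus the hyperbolic cosine of the distance, `y` is the point of the facet
  -- nearest to `x`.
  obtain ⟨y, hy, hmax⟩ := (P.isCompact_facet i).exists_isMaxOn (P.facet_nonempty i)
    (f := fun y : Hyp n => lor y.1 x.1) (Continuous.continuousOn (by fun_prop))
  refine ⟨y, hy, ?_⟩
  set v : LVec n := x.1 + lor x.1 y.1 • y.1 - lor x.1 (P.normal i) • P.normal i with hv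
  have hyi : lor y.1 (P.normal i) = 0 := hy.2
  have hvy : lor v y.1 = 0 := by
    simp only [hv, lor_sub_left, lor_add_left, lor_smul_left, y.lor_self,
      lor_comm (P.normal i) y.1, hyi]
    ring
  have hvi : lor v (P.normal i) = 0 := by
    simp only [hv, lor_sub_left, lor_add_left, lor_smul_left, P.unit, hyi]
    ring
  have hvx : lor v x.1 = lor v v := by
    conv_rhs => rw [hv, lor_sub_right, lor_add_right, lor_smul_right, lor_smul_right, ← hv, hvy,
      hvi]
    ring
  -- Right angles enter here: at a wall through `y` other than `i`, the product with `v` equals the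
  -- product with `x`, so no wall through `y` blocks the direction `v`.
  have hvk : ∀ k, lor y.1 (P.normal k) = 0 → lor v (P.normal k) ≤ 0 := by
    intro k hk
    by_cases hki : k = i
    · rw [hki, hvi]
    · have : lor (P.normal i) (P.normal k) = 0 :=
        Meets.orthogonal ⟨y, hy, hy.1, hk⟩ (Ne.symm hki)
      simp only [hv, lor_sub_left, lor_add_left, lor_smul_left, this, hk]
      linarith [hx k]
  have hv0 : v = 0 := by
    apply eq_zero_of_orthogonal y hvy
    by_contra hq
    have hq := not_le.1 hq
    -- Moving from `y` along `v` gains `t * lor v v` to first order; this bound on `t` makes the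
    -- gain exceed the second-order loss from normalizing, so the new point of the facet is nearer
    -- to `x`.
    have h1 : ∀ᶠ t : ℝ in 𝓝[>] 0, t * (-lor y.1 x.1) < 1 := by
      have h : Continuous fun t : ℝ => t * (-lor y.1 x.1) := by fun_prop
      have := h.tendsto 0
      rw [zero_mul] at this
      exact (this.eventually_lt_const one_pos).filter_mono nhdsWithin_le_nhds
    obtain ⟨t, ht0, ht1, ht2, ht3⟩ := (eventually_mem_nhdsWithin.and (h1.and
      (((eventually_future y v).filter_mono nhdsWithin_le_nhds).and
      ((P.eventually_lor_neg y v).filter_mono nhdsWithin_le_nhds)))).exists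
    have ht0 : 0 < t := ht0
    have hn := lor_neg_of_norm_lt ht2
    have hpos := (norm_nonneg _).trans_lt ht2
    set z := hypNormalize _ hn hpos with hz
    have hzv : z.1 = (√(-lor (y.1 + t • v) (y.1 + t • v)))⁻¹ • (y.1 + t • v) := rfl
    have hN : -lor (y.1 + t • v) (y.1 + t • v) = 1 - t ^ 2 * lor v v := by
      simp only [lor_add_left, lor_add_right, lor_smul_left, lor_smul_right, y.lor_self,
        lor_comm y.1 v, hvy]
      ring
    have hNpos : 0 < 1 - t ^ 2 * lor v v := by rw [← hN]; linarith
    have hs := Real.sqrt_pos.2 hNpos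
    rw [hN] at hzv
    have hzF : z ∈ P.facet i := by
      constructor
      · intro k
        rw [hzv, lor_smul_left]
        refine mul_nonpos_of_nonneg_of_nonpos (inv_nonneg.2 hs.le) ?_
        rcases (hy.1 k).eq_or_lt with h | h
        · rw [lor_add_left, lor_smul_left, h]
          have := mul_nonpos_of_nonneg_of_nonpos ht0.le (hvk k h)
          linarith
        · exact (ht3 k h).le
      · rw [hzv, lor_smul_left, lor_add_left, lor_smul_left, hyi, hvi]; ring
    have h2 : lor z.1 x.1 ≤ lor y.1 x.1 := hmax hzF
    rw [hzv, lor_smul_left, lor_add_left, lor_smul_left, hvx, inv_mul_le_iff₀ hs] at h2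
    have h3 : 1 - t ^ 2 * lor v v ≤ √(1 - t ^ 2 * lor v v) := by
      apply Real.le_sqrt_of_sq_le
      nlinarith [sq_nonneg t, mul_nonneg (sq_nonneg t) hq.le]
    have h4 := Hyp.lor_neg y x
    have h5 : √(1 - t ^ 2 * lor v v) * lor y.1 x.1 ≤ (1 - t ^ 2 * lor v v) * lor y.1 x.1 :=
      mul_le_mul_of_nonpos_right h3 h4.le
    have h6 : t * lor v v * (t * -lor y.1 x.1) < t * lor v v * 1 :=
      mul_lt_mul_of_pos_left ht1 (mul_pos ht0 hq)
    linarith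
  have h7 : x.1 = v - lor x.1 y.1 • y.1 + lor x.1 (P.normal i) • P.normal i := by
    rw [hv]; module
  rw [hv0] at h7
  exact h7.trans (by module)

/-- The hyperplanes of disjoint facets do not meet in hyperbolic space. -/
theorem lor_normal_le {i j : ι} (hij : ¬P.Meets i j) :
    lor (P.normal i) (P.normal j) ≤ -1 := by
  -- Go from the point `x` of facet `j` nearest to the hyperplane of `i` to its foot `y` on facet
  -- `i`, and back to the foot `z` of `y` on facet `j`.
  obtain ⟨x, hx, hmax⟩ := (P.isCompact_facet j).exists_isMaxOn (P.facet_nonempty j)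
    (f := fun y : Hyp n => lor y.1 (P.normal i)) (Continuous.continuousOn (by fun_prop))
  obtain ⟨y, hy, hxy⟩ := P.exists_foot hx.1 i
  obtain ⟨z, hz, hyz⟩ := P.exists_foot hy.1 j
  have hδ : lor x.1 (P.normal i) < 0 :=
    lt_of_le_of_ne (hx.1 i) fun h => hij ⟨x, ⟨hx.1, h⟩, hx⟩
  have ha := Hyp.lor_le x y
  have ha' := Hyp.lor_le y z
  have hzx : lor z.1 (P.normal i) ≤ lor x.1 (P.normal i) := hmax hz
  have e1 := congrArg (fun v => lor v (P.normal j)) hxy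
  have e2 := congrArg (fun v => lor v (P.normal i)) hyz
  simp only [lor_add_left, lor_smul_left] at e1 e2
  rw [show lor x.1 (P.normal j) = 0 from hx.2] at e1
  rw [show lor y.1 (P.normal i) = 0 from hy.2, lor_comm (P.normal j)] at e2
  have hyj := hy.1 j
  generalize lor (P.normal i) (P.normal j) = c at *
  generalize lor x.1 (P.normal i) = d at *
  generalize lor y.1 (P.normal j) = e at *
  generalize lor z.1 (P.normal i) = f at *
  generalize lor x.1 y.1 = a at *
  generalize lor y.1 z.1 = b at *
  have hc : c ≤ 0 := by
    by_contra hc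
    nlinarith [mul_neg_of_neg_of_pos hδ (not_le.1 hc)]
  -- If `-1 < c`, the round trip gives `-f ≤ -d * c ^ 2 < -d`, so `z` would be nearer to the
  -- hyperplane of `i` than `x`.
  by_contra hc1
  have hc1 := not_le.1 hc1
  have k1 : -e ≤ d * c := by nlinarith
  have k2 : -f ≤ e * c := by nlinarith
  have k3 : e * c ≤ (d * c) * (-c) := by nlinarith
  have k4 : -d * (c * c) < -d * 1 := mul_lt_mul_of_pos_left (by nlinarith) (by linarith)
  linarith

theorem gen_smul (i : ι) (x : Hyp n) : P.gen i • x = P.s i x := rfl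

theorem s_coe (i : ι) (x : Hyp n) : (P.s i x).1 = lorReflect (P.normal i) x.1 := rfl

theorem lor_s (i j : ι) (x : Hyp n) : lor (P.s i x).1 (P.normal j) =
    lor x.1 (P.normal j) - 2 * lor x.1 (P.normal i) * lor (P.normal i) (P.normal j) := by
  rw [s_coe, lorReflect, lor_sub_left, lor_smul_left]

theorem lor_s_self (i : ι) (x : Hyp n) :
    lor (P.s i x).1 (P.normal i) = -lor x.1 (P.normal i) := by
  rw [lor_s, P.unit]; ring

theorem s_s (i : ι) (x : Hyp n) : P.s i (P.s i x) = x :=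
  Subtype.ext (lorReflect_lorReflect (P.unit i) x.1)

theorem s_eq_self {i : ι} {x : Hyp n} (h : lor x.1 (P.normal i) = 0) : P.s i x = x :=
  Subtype.ext (by rw [s_coe, lorReflect, h]; simp)

theorem gen_mul_self (i : ι) : P.gen i * P.gen i = 1 :=
  Subtype.ext (Equiv.ext fun x => P.s_s i x)

theorem gen_inv (i : ι) : (P.gen i)⁻¹ = P.gen i := inv_eq_of_mul_eq_one_left (P.gen_mul_self i)

theorem closure_gen : Subgroup.closure (Set.range P.gen) = ⊤ := by
  rw [eq_top_iff]
  rintro ⟨w, hw⟩ -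
  induction hw using Subgroup.closure_induction with
  | mem x hx =>
    obtain ⟨i, rfl⟩ := hx
    exact Subgroup.subset_closure ⟨i, rfl⟩
  | one => exact one_mem _
  | mul x y hx hy h1 h2 => exact mul_mem h1 h2
  | inv x hx h => exact inv_mem h

/-- Induction on elements of the reflection group, multiplying by generators on the right. -/
theorem W_induction {p : P.W → Prop} (w : P.W) (one : p 1)
    (mul : ∀ w i, p w → p (w * P.gen i)) : p w := by
  have hw : w ∈ Subgroup.closure (Set.range P.gen) := by rw [closure_gen]; trivial
  induction hw using Subgroup.closure_induction_right with
  | one => exact one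
  | mul_right x y hx hy h =>
    obtain ⟨i, rfl⟩ := hy
    exact mul _ _ h
  | mul_inv_cancel x y hx hy h =>
    obtain ⟨i, rfl⟩ := hy
    rw [gen_inv]
    exact mul _ _ h

theorem lor_smul_smul (w : P.W) (x y : Hyp n) : lor (w • x).1 (w • y).1 = lor x.1 y.1 := by
  induction w using P.W_induction generalizing x y with
  | one => simp
  | mul w i h => rw [mul_smul, mul_smul, h]; exact hypReflection_lor (P.unit i) x y

theorem isHypIsometry_W (w : P.W) : IsHypIsometry w.1 :=
  isHypIsometry_of_lor (P.lor_smul_smul w)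

theorem continuous_W_smul (w : P.W) : Continuous fun x : Hyp n => w • x :=
  (P.isHypIsometry_W w).continuous

open Classical in
/-- The Coxeter matrix of a right-angled polytope: reflections across facets that meet commute. -/
noncomputable def coxeterMatrix : CoxeterMatrix ι where
  M := Matrix.of fun i j => if i = j then 1 else if P.Meets i j then 2 else 0
  isSymm := by
    ext i j
    have : P.Meets j i ↔ P.Meets i j := ⟨Meets.symm, Meets.symm⟩
    simp [Matrix.transpose_apply, eq_comm, this]
  diagonal i := by simp
  off_diagonal i j h := by
    simp only [Matrix.of_apply, h, if_false]
    split_ifs <;> norm_num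

theorem coxeterMatrix_self (i : ι) : P.coxeterMatrix i i = 1 := by simp [coxeterMatrix]

theorem coxeterMatrix_meets {i j : ι} (h : i ≠ j) (hm : P.Meets i j) :
    P.coxeterMatrix i j = 2 := by simp [coxeterMatrix, h, hm]

theorem coxeterMatrix_not_meets {i j : ι} (h : i ≠ j) (hm : ¬P.Meets i j) :
    P.coxeterMatrix i j = 0 := by simp [coxeterMatrix, h, hm]

theorem gen_comm {i j : ι} (h : lor (P.normal i) (P.normal j) = 0) :
    P.gen i * P.gen j = P.gen j * P.gen i := by
  refine Subtype.ext (Equiv.ext fun x => Subtype.ext ?_)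
  change lorReflect _ (lorReflect _ x.1) = lorReflect _ (lorReflect _ x.1)
  simp only [lorReflect, lor_sub_left, lor_smul_left, h, lor_comm (P.normal j)]
  module

/-- A permutation of the facets that preserves incidence satisfies the Coxeter relations. -/
theorem isLiftable_gen {σ : ι → ι} (hσ : ∀ i j, P.Meets i j → P.Meets (σ i) (σ j))
    (hinj : Function.Injective σ) :
    P.coxeterMatrix.IsLiftable fun i => P.gen (σ i) := by
  intro i j
  by_cases h : i = j
  · rw [h, coxeterMatrix_self, pow_one, gen_mul_self]
  · by_cases hm : P.Meets i j
    · have hc := P.gen_comm ((hσ i j hm).orthogonal (hinj.ne h))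
      rw [coxeterMatrix_meets P h hm, pow_two]
      nth_rewrite 2 [hc]
      rw [mul_assoc, ← mul_assoc (P.gen (σ j)), gen_mul_self, one_mul, gen_mul_self]
    · rw [coxeterMatrix_not_meets P h hm, pow_zero]

/-- The standard Coxeter system on the abstract right-angled Coxeter group of the polytope. -/
noncomputable abbrev cox : CoxeterSystem P.coxeterMatrix P.coxeterMatrix.Group :=
  P.coxeterMatrix.toCoxeterSystem

/-- The canonical map from the abstract Coxeter group to the reflection group. -/
noncomputable def toW : P.coxeterMatrix.Group →* P.W :=
  P.cox.lift ⟨P.gen, P.isLiftable_gen (σ := id) (fun _ _ h => h) Function.injective_id⟩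

theorem toW_simple (i : ι) : P.toW (P.cox.simple i) = P.gen i :=
  P.cox.lift_apply_simple _ i

/-- Restoring a last letter `s_j` reflects the point in wall `j`; this is the inductive step for
lengths. -/
theorem toW_inv_mul_simple (g : P.coxeterMatrix.Group) (j : ι) (x : Hyp n) :
    (P.toW g)⁻¹ • x = P.s j ((P.toW (g * P.cox.simple j))⁻¹ • x) := by
  rw [map_mul, mul_inv_rev, toW_simple, gen_inv, mul_smul, gen_smul, s_s]

/-- Tits' lemma: the length function detects the side of a facet on which a tile lies. -/
theorem tits_lemma (N : ℕ) (g : P.coxeterMatrix.Group) (hg : P.cox.length g = N) {x : Hyp n}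
    (hx : x ∈ P.body) :
    (∀ i, ¬P.cox.IsRightDescent g i → lor ((P.toW g)⁻¹ • x).1 (P.normal i) ≤ 0) ∧
    ∀ i j, i ≠ j → ¬P.Meets i j → P.cox.IsRightDescent g j →
      0 ≤ lor ((P.toW g)⁻¹ • x).1 (P.normal j) ∧
      lor ((P.toW g)⁻¹ • x).1 (P.normal i) + lor ((P.toW g)⁻¹ • x).1 (P.normal j) ≤ 0 := by
  induction N using Nat.strong_induction_on generalizing g with
  | _ N ih =>
  -- The second claim carries the induction through infinite dihedral subgroups. With `z` the point
  -- for the shorter element, `lor z (normal j) ≤ 0` and `lor (normal i) (normal j) ≤ -1` show that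
  -- reflecting in wall `j` makes the sum at most the sum of the two products of `z`.
  have key : ∀ i j, i ≠ j → ¬P.Meets i j → P.cox.IsRightDescent g j →
      0 ≤ lor ((P.toW g)⁻¹ • x).1 (P.normal j) ∧
      lor ((P.toW g)⁻¹ • x).1 (P.normal i) + lor ((P.toW g)⁻¹ • x).1 (P.normal j) ≤ 0 := by
    intro i j hij hm hj
    obtain ⟨ih1, ih2⟩ := ih _ (hg ▸ hj) (g * P.cox.simple j) rfl
    have hj' := P.cox.isRightDescent_iff_not_isRightDescent_mul.1 hj
    rw [P.toW_inv_mul_simple g j x, lor_s_self, lor_s]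
    have h1 := ih1 j hj'
    have hc := P.lor_normal_le hm
    rw [lor_comm] at hc
    generalize (P.toW (g * P.cox.simple j))⁻¹ • x = z at *
    by_cases hi : P.cox.IsRightDescent (g * P.cox.simple j) i
    · obtain ⟨h2, h3⟩ := ih2 j i hij.symm (fun h => hm h.symm) hi
      constructor <;> nlinarith
    · have h2 := ih1 i hi
      constructor <;> nlinarith
  refine ⟨fun i hi => ?_, key⟩
  by_cases h1 : g = 1
  · subst h1
    simpa using hx i
  obtain ⟨j, hj⟩ := P.cox.exists_rightDescent_of_ne_one h1
  have hij : i ≠ j := fun h => hi (h ▸ hj)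
  -- If the facets meet, reflecting in wall `j` leaves the product with `normal i` unchanged. The
  -- generators commute, so a descent `i` of `g * s_j` would be one of `g`.
  by_cases hm : P.Meets i j
  · obtain ⟨ih1, -⟩ := ih _ (hg ▸ hj) (g * P.cox.simple j) rfl
    rw [P.toW_inv_mul_simple g j x, lor_s, hm.symm.orthogonal hij.symm, mul_zero, sub_zero]
    apply ih1
    intro hd
    apply hi
    have hcomm : P.cox.simple j * P.cox.simple i = P.cox.simple i * P.cox.simple j := by
      have := P.cox.simple_mul_simple_pow i j
      rw [coxeterMatrix_meets P hij hm, pow_two] at this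
      have h3 := eq_inv_of_mul_eq_one_left this
      rw [mul_inv_rev, P.cox.inv_simple, P.cox.inv_simple] at h3
      exact h3.symm
    have h3 : g * P.cox.simple i = g * P.cox.simple j * P.cox.simple i * P.cox.simple j := by
      rw [mul_assoc g, mul_assoc g, hcomm, mul_assoc (P.cox.simple i),
        P.cox.simple_mul_simple_self, mul_one]
    unfold CoxeterSystem.IsRightDescent at hd hj ⊢
    rw [h3]
    rcases P.cox.length_mul_simple (g * P.cox.simple j * P.cox.simple i) j with h | h <;> omega
  · have := key i j hij hm hj
    linarith [this.1, this.2]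

theorem lor_nonneg_of_descent {g : P.coxeterMatrix.Group} {j : ι}
    (hj : P.cox.IsRightDescent g j) {x : Hyp n} (hx : x ∈ P.body) :
    0 ≤ lor ((P.toW g)⁻¹ • x).1 (P.normal j) := by
  have h := (P.tits_lemma _ (g * P.cox.simple j) rfl hx).1 j
    (P.cox.isRightDescent_iff_not_isRightDescent_mul.1 hj)
  rw [P.toW_inv_mul_simple g j x, lor_s_self]
  linarith

/-- A nontrivial element of the kernel would have a right descent `j`, and the identity would then
put an interior point on the far side of wall `j`. -/
theorem toW_injective : Function.Injective P.toW := by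
  rw [injective_iff_map_eq_one]
  intro g hg
  by_contra h
  obtain ⟨j, hj⟩ := P.cox.exists_rightDescent_of_ne_one h
  obtain ⟨x, hx⟩ := P.solid
  have := P.lor_nonneg_of_descent hj (x := x) fun i => (hx i).le
  rw [hg, inv_one, one_smul] at this
  linarith [hx j]

theorem toW_surjective : Function.Surjective P.toW := fun w => by
  induction w using P.W_induction with
  | one => exact ⟨1, map_one _⟩
  | mul w i h =>
    obtain ⟨g, rfl⟩ := h
    exact ⟨g * P.cox.simple i, by rw [map_mul, toW_simple]⟩

/-- The reflection group is the abstract right-angled Coxeter group. -/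
noncomputable def equivW : P.coxeterMatrix.Group ≃* P.W :=
  MulEquiv.ofBijective P.toW ⟨P.toW_injective, P.toW_surjective⟩

/-- A map defined on generators that respects incidence of facets extends to the group. -/
theorem exists_hom {σ : ι → ι} (hσ : ∀ i j, P.Meets i j → P.Meets (σ i) (σ j))
    (hinj : Function.Injective σ) : ∃ a : P.W →* P.W, ∀ i, a (P.gen i) = P.gen (σ i) := by
  refine ⟨(P.cox.lift ⟨_, P.isLiftable_gen hσ hinj⟩).comp P.equivW.symm.toMonoidHom, fun i => ?_⟩
  have : P.equivW.symm (P.gen i) = P.cox.simple i := by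
    rw [MulEquiv.symm_apply_eq]
    exact (P.toW_simple i).symm
  rw [MonoidHom.comp_apply]
  change P.cox.lift _ (P.equivW.symm (P.gen i)) = _
  rw [this]
  exact P.cox.lift_apply_simple _ i

theorem hom_ext_gen {G : Type*} [Monoid G] {a b : P.W →* G} (h : ∀ i, a (P.gen i) = b (P.gen i)) :
    a = b := by
  ext w
  induction w using P.W_induction with
  | one => rw [map_one, map_one]
  | mul w i hw => rw [map_mul, map_mul, hw, h]

theorem exists_mulEquiv (σ : Equiv.Perm ι) (hσ : ∀ i j, P.Meets i j ↔ P.Meets (σ i) (σ j)) :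
    ∃ a : P.W ≃* P.W, ∀ i, a (P.gen i) = P.gen (σ i) := by
  obtain ⟨a, ha⟩ := P.exists_hom (fun i j h => (hσ i j).1 h) σ.injective
  obtain ⟨b, hb⟩ := P.exists_hom (σ := σ.symm)
    (fun i j h => (hσ _ _).2 (by simpa using h)) σ.symm.injective
  refine ⟨a.toMulEquiv b (P.hom_ext_gen fun i => ?_) (P.hom_ext_gen fun i => ?_), ha⟩
  · simp [ha, hb]
  · simp [ha, hb]

/-- The labels of the facets through a point. -/
def supp (x : Hyp n) : Set ι := {i | lor x.1 (P.normal i) = 0}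

/-- The subgroup generated by the reflections across the facets through a point. -/
def localW (x : Hyp n) : Subgroup P.W := Subgroup.closure (P.gen '' P.supp x)

theorem smul_eq_of_mem_localW {x : Hyp n} {w : P.W} (hw : w ∈ P.localW x) : w • x = x := by
  have : P.localW x ≤ MulAction.stabilizer P.W x := by
    rw [localW, Subgroup.closure_le]
    rintro _ ⟨i, hi, rfl⟩
    exact P.s_eq_self hi
  exact this hw

/-- The polytope is a strict fundamental domain, with the expected stabilizers. -/
theorem eq_of_smul_mem_body {x : Hyp n} (hx : x ∈ P.body) (w : P.W) (hw : w • x ∈ P.body) :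
    w • x = x ∧ w ∈ P.localW x := by
  obtain ⟨g, rfl⟩ := P.toW_surjective w
  induction hN : P.cox.length g using Nat.strong_induction_on generalizing g with
  | _ N ih =>
  by_cases h1 : g = 1
  · subst h1
    rw [map_one, one_smul]
    exact ⟨rfl, one_mem _⟩
  obtain ⟨j, hj⟩ := P.cox.exists_rightDescent_of_ne_one h1
  have h2 := P.lor_nonneg_of_descent hj hw
  rw [inv_smul_smul] at h2
  -- The descent puts `x` on the far side of wall `j`, membership in the polytope on the near side.
  -- So `s_j` fixes `x`, and the last letter can be dropped.
  have h3 : j ∈ P.supp x := le_antisymm (hx j) h2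
  have h4 : P.gen j • x = x := P.s_eq_self h3
  have h5 : P.toW g = P.toW (g * P.cox.simple j) * P.gen j := by
    rw [← toW_simple, ← map_mul, mul_assoc, P.cox.simple_mul_simple_self, mul_one]
  rw [h5, mul_smul, h4] at hw ⊢
  obtain ⟨e1, e2⟩ := ih _ (hN ▸ hj) _ hw rfl
  exact ⟨e1, mul_mem e2 (Subgroup.subset_closure ⟨j, h3, rfl⟩)⟩

end RAPolytope

/-! ### The tessellation by copies of the polytope, and equivariant extension of maps. -/

namespace RAPolytope

variable {n : ℕ} {ι : Type*} (P : RAPolytope n ι)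

/-- Fold across one wall at a time: walls through `x` are pairwise orthogonal, so reflecting in one
keeps the sides already achieved for the others. Finiteness of `V` allows shrinking neighbourhoods
in `exists_local_fold`. -/
theorem exists_finite_fold {x : Hyp n} (hx : x ∈ P.body) (A : Finset ι)
    (hA : ∀ i ∈ A, i ∈ P.supp x) : ∃ V : Set P.W, V.Finite ∧ (∀ v ∈ V, v ∈ P.localW x) ∧
    ∀ y : Hyp n, ∃ v ∈ V, ∀ k ∈ A, lor (v • y).1 (P.normal k) ≤ 0 := by
  classical
  induction A using Finset.induction_on with
  | empty => exact ⟨{1}, Set.finite_singleton _, by simp [one_mem], by simp⟩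
  | insert i A hi ih =>
    obtain ⟨V, hV, hVx, h⟩ := ih fun j hj => hA j (Finset.mem_insert_of_mem hj)
    refine ⟨V ∪ (fun v => P.gen i * v) '' V, hV.union (hV.image _), ?_, fun y => ?_⟩
    · rintro _ (hv | ⟨v, hv, rfl⟩)
      · exact hVx _ hv
      · exact mul_mem (Subgroup.subset_closure ⟨i, hA i (Finset.mem_insert_self _ _), rfl⟩)
          (hVx _ hv)
    · obtain ⟨v, hv, hvy⟩ := h y
      by_cases hiv : lor (v • y).1 (P.normal i) ≤ 0
      · refine ⟨v, Or.inl hv, fun k hk => ?_⟩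
        rcases Finset.mem_insert.1 hk with rfl | hk
        · exact hiv
        · exact hvy k hk
      · refine ⟨P.gen i * v, Or.inr ⟨v, hv, rfl⟩, fun k hk => ?_⟩
        rw [mul_smul, gen_smul]
        rcases Finset.mem_insert.1 hk with rfl | hk
        · rw [lor_s_self]; linarith
        · have hik : i ≠ k := fun h => hi (h ▸ hk)
          have : P.Meets i k := ⟨x, ⟨hx, hA i (Finset.mem_insert_self _ _)⟩,
            ⟨hx, hA k (Finset.mem_insert_of_mem hk)⟩⟩
          rw [lor_s, this.orthogonal hik, mul_zero, sub_zero]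
          exact hvy k hk

/-- Near a point of the polytope, finitely many elements of its local group fold space into the
polytope. -/
theorem exists_local_fold {x : Hyp n} (hx : x ∈ P.body) :
    ∃ V : Set P.W, V.Finite ∧ (∀ v ∈ V, v ∈ P.localW x) ∧
      ∀ᶠ y in 𝓝 x, ∃ v ∈ V, v • y ∈ P.body := by
  have := P.finite_facets
  obtain ⟨V, hV, hVx, h⟩ := P.exists_finite_fold hx (Set.toFinite (P.supp x)).toFinset
    (by simp)
  refine ⟨V, hV, hVx, ?_⟩
  have h1 : ∀ᶠ y in 𝓝 x, ∀ v ∈ V, ∀ k, lor x.1 (P.normal k) < 0 →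
      lor (v • y).1 (P.normal k) < 0 := by
    rw [hV.eventually_all]
    intro v hv
    rw [eventually_all]
    intro k
    by_cases hk : lor x.1 (P.normal k) < 0
    · have hc : Continuous fun y : Hyp n => lor (v • y).1 (P.normal k) :=
        Continuous.lor (continuous_subtype_val.comp (P.continuous_W_smul v)) continuous_const
      have h2 := hc.tendsto x
      rw [P.smul_eq_of_mem_localW (hVx v hv)] at h2
      filter_upwards [h2.eventually_lt_const hk] with y hy _ using hy
    · exact Eventually.of_forall fun y h => absurd h hk
  filter_upwards [h1] with y hy
  obtain ⟨v, hv, hvy⟩ := h y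
  refine ⟨v, hv, fun k => ?_⟩
  rcases (hx k).eq_or_lt with h2 | h2
  · exact hvy k ((Set.Finite.mem_toFinset _).2 h2)
  · exact (hy v hv k h2).le

/-- The tiles cover hyperbolic space. -/
theorem exists_smul_mem_body (y : Hyp n) : ∃ w : P.W, w • y ∈ P.body := by
  obtain ⟨x₀, hx₀⟩ := P.solid
  -- The orbit is not yet known to be closed, so the distance to `x₀` is minimized over its closure.
  -- A minimizer beyond some wall would come nearer to `x₀` when reflected in that wall.
  have hK : IsCompact (closure (MulAction.orbit P.W y) ∩ {z | -lor z.1 x₀.1 ≤ -lor y.1 x₀.1}) :=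
    (Hyp.isCompact_sublevel x₀ _).inter_left isClosed_closure
  obtain ⟨z, hz, hmin⟩ := hK.exists_isMinOn
    ⟨y, subset_closure (MulAction.mem_orbit_self y), le_refl (-lor y.1 x₀.1)⟩
    (f := fun z : Hyp n => -lor z.1 x₀.1) (Continuous.continuousOn (by fun_prop))
  have hzb : z ∈ P.body := by
    intro i
    by_contra hi
    have hi := not_le.1 hi
    have h1 : P.gen i • z ∈ closure (MulAction.orbit P.W y) :=
      map_mem_closure (P.continuous_W_smul (P.gen i)) hz.1 fun u hu => by
        obtain ⟨w, rfl⟩ := hu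
        exact ⟨P.gen i * w, mul_smul _ _ _⟩
    have h2 : -lor (P.gen i • z).1 x₀.1 < -lor z.1 x₀.1 := by
      rw [gen_smul, s_coe, lorReflect, lor_sub_left, lor_smul_left, lor_comm (P.normal i)]
      nlinarith [mul_neg_of_pos_of_neg hi (hx₀ i)]
    exact absurd (hmin ⟨h1, h2.le.trans hz.2⟩) (not_le.2 h2)
  -- Points of the orbit near the minimizer `z` can be folded into the polytope, which returns from
  -- the closure to the orbit.
  obtain ⟨V, -, -, hV⟩ := P.exists_local_fold hzb
  obtain ⟨_, ⟨v, -, hv⟩, ⟨w, rfl⟩⟩ := mem_closure_iff_nhds.1 hz.1 _ hV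
  exact ⟨v * w, by rw [mul_smul]; exact hv⟩

theorem exists_eq_smul (y : Hyp n) : ∃ w : P.W, ∃ x : P.body, y = w • x.1 := by
  obtain ⟨w, hw⟩ := P.exists_smul_mem_body y
  exact ⟨w⁻¹, ⟨_, hw⟩, by rw [inv_smul_smul]⟩

theorem eq_of_smul_eq_smul {v w : P.W} {x y : P.body} (h : v • x.1 = w • y.1) :
    x = y ∧ w⁻¹ * v ∈ P.localW x.1 := by
  have h1 : (w⁻¹ * v) • x.1 = y.1 := by rw [mul_smul, h, inv_smul_smul]
  obtain ⟨h2, h3⟩ := P.eq_of_smul_mem_body x.2 (w⁻¹ * v) (h1 ▸ y.2)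
  exact ⟨Subtype.ext (h2.symm.trans h1), h3⟩

variable {P}

/-- The map of hyperbolic space that is equivariant along `a` and extends `f`. -/
noncomputable def equivariantExt (f : P.body → P.body) (a : P.W → P.W) (z : Hyp n) : Hyp n :=
  a (P.exists_eq_smul z).choose • (f (P.exists_eq_smul z).choose_spec.choose).1

theorem map_mem_localW {f : P.body → P.body} {a : P.W →* P.W} {σ : ι → ι}
    (ha : ∀ i, a (P.gen i) = P.gen (σ i)) (hf : ∀ x i, i ∈ P.supp x.1 → σ i ∈ P.supp (f x).1)
    {x : P.body} {w : P.W} (hw : w ∈ P.localW x.1) : a w ∈ P.localW (f x).1 := by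
  have : P.localW x.1 ≤ (P.localW (f x).1).comap a := by
    rw [localW, Subgroup.closure_le]
    rintro _ ⟨i, hi, rfl⟩
    exact Subgroup.subset_closure ⟨σ i, hf x i hi, (ha i).symm⟩
  exact this hw

section

variable {f : P.body → P.body} {a : P.W →* P.W} {σ : ι → ι}
  (ha : ∀ i, a (P.gen i) = P.gen (σ i)) (hf : ∀ x i, i ∈ P.supp x.1 → σ i ∈ P.supp (f x).1)

include ha hf

/-- Independence of the representation chosen in `equivariantExt`: two of them differ by the local
group of `x`, and `a` maps this into the local group of `f x`, which fixes `f x`. -/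
theorem equivariantExt_smul (w : P.W) (x : P.body) :
    equivariantExt f a (w • x.1) = a w • (f x).1 := by
  have h := (P.exists_eq_smul (w • x.1)).choose_spec.choose_spec
  obtain ⟨h1, h2⟩ := P.eq_of_smul_eq_smul h.symm
  have h3 := P.smul_eq_of_mem_localW (map_mem_localW ha hf h2)
  rw [equivariantExt]
  rw [h1] at h3
  rw [h1]
  rw [map_mul, mul_smul, map_inv, inv_smul_eq_iff] at h3
  exact h3

theorem equivariantExt_smul_smul (w : P.W) (z : Hyp n) :
    equivariantExt f a (w • z) = a w • equivariantExt f a z := by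
  obtain ⟨v, x, rfl⟩ := P.exists_eq_smul z
  rw [← mul_smul, equivariantExt_smul ha hf, equivariantExt_smul ha hf, map_mul, mul_smul]

/-- Near a point `x` of the polytope, the extension at `y` is one of finitely many expressions `a
v⁻¹ • f (v • y)`, each continuous where defined and with value `f x` at `x`. Equivariance transports
this to every tile. -/
theorem continuous_equivariantExt (hfc : Continuous f) : Continuous (equivariantExt f a) := by
  have key : ∀ x : P.body, ContinuousAt (equivariantExt f a) x.1 := by
    intro x
    obtain ⟨V, hV, hVx, h⟩ := P.exists_local_fold x.2
    have hx : equivariantExt f a x.1 = (f x).1 := by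
      simpa using equivariantExt_smul ha hf 1 x
    rw [ContinuousAt, hx, tendsto_def]
    intro N hN
    have h1 : ∀ᶠ y in 𝓝 x.1, ∀ v ∈ V, ∀ hy : v • y ∈ P.body, a v⁻¹ • (f ⟨v • y, hy⟩).1 ∈ N := by
      rw [hV.eventually_all]
      intro v hv
      have hvx := P.smul_eq_of_mem_localW (hVx v hv)
      have h2 : ∀ᶠ z : P.body in 𝓝 x, a v⁻¹ • (f z).1 ∈ N := by
        have hc : Continuous fun z : P.body => a v⁻¹ • (f z).1 :=
          (P.continuous_W_smul _).comp (continuous_subtype_val.comp hfc)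
        have h4 := P.smul_eq_of_mem_localW (map_mem_localW ha hf (inv_mem (hVx v hv)))
        have h3 := hc.tendsto x
        rw [h4] at h3
        exact h3 hN
      rw [nhds_subtype_eq_comap, eventually_comap] at h2
      have h5 := (P.continuous_W_smul v).tendsto x.1
      rw [hvx] at h5
      filter_upwards [h5.eventually h2] with y hy hyb using hy ⟨_, hyb⟩ rfl
    filter_upwards [h, h1] with y ⟨v, hv, hvy⟩ hy
    have h6 := hy v hv hvy
    rw [← equivariantExt_smul ha hf, inv_smul_smul] at h6
    exact h6
  rw [continuous_iff_continuousAt]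
  intro z
  obtain ⟨w, x, rfl⟩ := P.exists_eq_smul z
  have h1 : equivariantExt f a = fun z => a w • equivariantExt f a (w⁻¹ • z) := by
    funext z
    rw [← equivariantExt_smul_smul ha hf, smul_inv_smul]
  rw [h1]
  refine ((P.continuous_W_smul (a w)).continuousAt).comp ?_
  refine ContinuousAt.comp (g := equivariantExt f a) ?_ (P.continuous_W_smul w⁻¹).continuousAt
  rw [inv_smul_smul]
  exact key x

end

namespace CharFn

variable (l m : P.CharFn)

theorem proj_eq_iff {x y : Hyp n} : l.proj x = l.proj y ↔ ∃ k : P.W, l.hom k = 1 ∧ x = k • y := by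
  rw [proj, proj, Quotient.eq, MulAction.orbitRel_apply]
  constructor
  · rintro ⟨k, rfl⟩
    exact ⟨k.1, k.2, rfl⟩
  · rintro ⟨k, hk, rfl⟩
    exact ⟨⟨k, hk⟩, rfl⟩

theorem proj_surjective (z : l.SmallCover) : ∃ w : P.W, ∃ x : P.body, z = l.proj (w • x.1) := by
  obtain ⟨y, rfl⟩ := Quotient.exists_rep z
  obtain ⟨w, x, rfl⟩ := P.exists_eq_smul y
  exact ⟨w, x, rfl⟩

variable {l m}

theorem exists_continuous_map {f : P.body → P.body} {a : P.W →* P.W} {σ : ι → ι}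
    (ha : ∀ i, a (P.gen i) = P.gen (σ i)) (hf : ∀ x i, i ∈ P.supp x.1 → σ i ∈ P.supp (f x).1)
    (hfc : Continuous f) (hk : ∀ w, l.hom w = 1 → m.hom (a w) = 1) :
    ∃ φ : l.SmallCover → m.SmallCover, Continuous φ ∧
      ∀ (w : P.W) (x : P.body), φ (l.proj (w • x.1)) = m.proj (a w • (f x).1) := by
  refine ⟨Quotient.lift (fun z => m.proj (equivariantExt f a z)) ?_, ?_, fun w x => ?_⟩
  · intro x y h
    obtain ⟨k, hk1, rfl⟩ := l.proj_eq_iff.1 (Quotient.sound h)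
    exact m.proj_eq_iff.2 ⟨a k, hk k hk1, equivariantExt_smul_smul ha hf k y⟩
  · exact (continuous_quotient_mk'.comp (continuous_equivariantExt ha hf hfc)).quotient_lift _
  · change m.proj _ = _
    rw [equivariantExt_smul ha hf]

theorem image_mem_cells {f : P.body ≃ P.body} {a : P.W → P.W} {σ : Equiv.Perm ι}
    (hf : ∀ x i, i ∈ P.supp x.1 ↔ σ i ∈ P.supp (f x).1) {φ : l.SmallCover → m.SmallCover}
    (hφ : ∀ (w : P.W) (x : P.body), φ (l.proj (w • x.1)) = m.proj (a w • (f x).1))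
    {D : Set l.SmallCover} (hD : D ∈ l.cells) : φ '' D ∈ m.cells := by
  obtain ⟨w, hw, C, ⟨⟨c, hc⟩, S, rfl⟩, rfl⟩ := hD
  refine ⟨_, (a ⟨w, hw⟩).2, {x | x ∈ P.body ∧ ∀ i ∈ σ '' S, x ∈ P.facet i}, ⟨?_, _, rfl⟩, ?_⟩
  · refine ⟨(f ⟨c, hc.1⟩).1, (f ⟨c, hc.1⟩).2, ?_⟩
    rintro _ ⟨i, hi, rfl⟩
    exact ⟨(f ⟨c, hc.1⟩).2, (hf ⟨c, hc.1⟩ i).1 (hc.2 i hi).2⟩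
  · ext z
    constructor
    · rintro ⟨_, ⟨_, ⟨x, hx, rfl⟩, rfl⟩, rfl⟩
      refine ⟨_, ⟨(f ⟨x, hx.1⟩).1, ⟨(f ⟨x, hx.1⟩).2, ?_⟩, rfl⟩, (hφ ⟨w, hw⟩ ⟨x, hx.1⟩).symm⟩
      rintro _ ⟨i, hi, rfl⟩
      exact ⟨(f ⟨x, hx.1⟩).2, (hf ⟨x, hx.1⟩ i).1 (hx.2 i hi).2⟩
    · rintro ⟨_, ⟨y, hy, rfl⟩, rfl⟩
      obtain ⟨x, hx⟩ := f.surjective ⟨y, hy.1⟩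
      have hy' : y = (f x).1 := (congrArg Subtype.val hx).symm
      subst hy'
      refine ⟨_, ⟨_, ⟨x.1, ⟨x.2, fun i hi => ⟨x.2, ?_⟩⟩, rfl⟩, rfl⟩, hφ ⟨w, hw⟩ x⟩
      exact (hf x i).2 (hy.2 _ ⟨i, hi, rfl⟩).2

/-- A facet-permuting self-homeomorphism of the polytope, compatible with the characteristic
functions, induces a cellular homeomorphism of small covers. -/
theorem exists_cellIso (f : P.body ≃ₜ P.body) (a : P.W ≃* P.W) (σ : Equiv.Perm ι)
    (ha : ∀ i, a (P.gen i) = P.gen (σ i)) (hf : ∀ x i, i ∈ P.supp x.1 ↔ σ i ∈ P.supp (f x).1)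
    (hk : ∀ w, l.hom w = 1 ↔ m.hom (a w) = 1) :
    ∃ φ : l.SmallCover ≃ₜ m.SmallCover, IsCellIso φ ∧
      ∀ (w : P.W) (x : P.body), φ (l.proj (w • x.1)) = m.proj (a w • (f x).1) := by
  have ha' : ∀ i, a.symm (P.gen i) = P.gen (σ.symm i) := fun i => by
    rw [MulEquiv.symm_apply_eq, ha, Equiv.apply_symm_apply]
  have hf' : ∀ x i, i ∈ P.supp x.1 ↔ σ.symm i ∈ P.supp (f.symm x).1 := fun x i => by
    rw [hf (f.symm x), Equiv.apply_symm_apply, Homeomorph.apply_symm_apply]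
  obtain ⟨φ, hφc, hφ⟩ := exists_continuous_map (l := l) (m := m) (f := f) (a := a.toMonoidHom)
    (σ := σ) ha (fun x i => (hf x i).1) f.continuous fun w => (hk w).1
  obtain ⟨ψ, hψc, hψ⟩ := exists_continuous_map (l := m) (m := l) (f := f.symm)
    (a := a.symm.toMonoidHom) (σ := σ.symm) ha' (fun x i => (hf' x i).1) f.symm.continuous
    fun w h => (hk _).2 (by simpa using h)
  have hφ : ∀ (w : P.W) (x : P.body), φ (l.proj (w • x.1)) = m.proj (a w • (f x).1) := hφ
  have hψ : ∀ (w : P.W) (x : P.body), ψ (m.proj (w • x.1)) = l.proj (a.symm w • (f.symm x).1) :=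
    hψ
  have h1 : Function.LeftInverse ψ φ := fun z => by
    obtain ⟨w, x, rfl⟩ := l.proj_surjective z
    rw [hφ, hψ, MulEquiv.symm_apply_apply, Homeomorph.symm_apply_apply]
  have h2 : Function.RightInverse ψ φ := fun z => by
    obtain ⟨w, x, rfl⟩ := m.proj_surjective z
    rw [hψ, hφ, MulEquiv.apply_symm_apply, Homeomorph.apply_symm_apply]
  refine ⟨⟨⟨φ, ψ, h1, h2⟩, hφc, hψc⟩, fun D => ⟨fun hD => ?_, fun hD => ?_⟩, hφ⟩
  · exact image_mem_cells (f := f.toEquiv) hf hφ hD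
  · have h3 := image_mem_cells (f := f.symm.toEquiv) hf' hψ hD
    have h4 : ψ '' (φ '' D) = D := by rw [← Set.image_comp, h1.comp_eq_id, Set.image_id]
    exact h4 ▸ h3

end CharFn

end RAPolytope

/-! ### Barycentric subdivision: combinatorial symmetries become homeomorphisms. -/

namespace RAPolytope

variable {n : ℕ} {ι : Type*} (P : RAPolytope n ι)

/-- Such a `w` would be an ideal point of `P`: normalized vectors `x₀ + s • w` stay in `P` and run
off to infinity, against compactness. -/
theorem not_lightlike {w : LVec n} (hw : ∀ k, lor w (P.normal k) ≤ 0) (h0 : 0 < w.1) :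
    lor w w ≠ 0 := by
  intro hww
  obtain ⟨x₀, hx₀⟩ := P.solid
  obtain ⟨z₀, -, hmax⟩ := P.isCompact_body.exists_isMaxOn ⟨x₀, fun i => (hx₀ i).le⟩
    (f := fun z : Hyp n => -lor z.1 x₀.1) (Continuous.continuousOn (by fun_prop))
  set D := -lor z₀.1 x₀.1
  have hb : lor w x₀.1 < 0 := lor_neg_of_future (norm_le_of_lor_nonpos hww.le h0.le) h0 x₀.norm_lt
  set β := -lor w x₀.1 with hβ
  have hβ0 : 0 < β := by linarith
  -- With `s * β = 2 * D ^ 2`, the distance bound `(1 + s * β) ^ 2 ≤ (1 + 2 * (s * β)) * D ^ 2`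
  -- becomes `1 + 3 * D ^ 2 ≤ 0`.
  set s : ℝ := 2 * D ^ 2 / β with hs
  have hs0 : 0 ≤ s := by positivity
  have hsβ : s * β = 2 * D ^ 2 := by rw [hs]; field_simp
  have hvv : lor (x₀.1 + s • w) (x₀.1 + s • w) = -(1 + 2 * (s * β)) := by
    simp only [lor_add_left, lor_add_right, lor_smul_left, lor_smul_right, x₀.lor_self, hww,
      lor_comm x₀.1 w, hβ]
    ring
  have hv : 0 < 1 + 2 * (s * β) := by positivity
  have hv0 : 0 < (x₀.1 + s • w).1 := add_pos_of_pos_of_nonneg x₀.2.2 (mul_nonneg hs0 h0.le)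
  have hz : hypNormalize (x₀.1 + s • w) (by rw [hvv]; linarith) hv0 ∈ P.body := by
    intro k
    change lor (_ • _) _ ≤ 0
    rw [lor_smul_left]
    refine mul_nonpos_of_nonneg_of_nonpos (inv_nonneg.2 (Real.sqrt_nonneg _)) ?_
    rw [lor_add_left, lor_smul_left]
    have := mul_nonpos_of_nonneg_of_nonpos hs0 (hw k)
    linarith [hx₀ k]
  have h1 : -lor ((√(-lor (x₀.1 + s • w) (x₀.1 + s • w)))⁻¹ • (x₀.1 + s • w)) x₀.1 ≤ D := hmax hz
  have hsq : 0 < √(1 + 2 * (s * β)) := Real.sqrt_pos.2 hv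
  rw [hvv, neg_neg, lor_smul_left, lor_add_left, lor_smul_left, x₀.lor_self, ← mul_neg,
    inv_mul_le_iff₀ hsq] at h1
  have h2 : 1 + s * β ≤ √(1 + 2 * (s * β)) * D := by rw [hβ]; linarith
  have h3 := pow_le_pow_left₀ (by positivity) h2 2
  rw [mul_pow, Real.sq_sqrt hv.le, hsβ] at h3
  nlinarith [sq_nonneg D]

/-- By compactness, the closed cone over the polytope lies in the open light cone. -/
theorem norm_lt_of_mem_cone {v : LVec n} (hv : ∀ k, lor v (P.normal k) ≤ 0) (h0 : 0 ≤ v.1)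
    (hne : v ≠ 0) : ‖v.2‖ < v.1 := by
  by_contra hn
  have hn := not_lt.1 hn
  have hq : 0 ≤ lor v v := by
    simp only [lor, real_inner_self_eq_norm_sq]
    nlinarith
  rcases hq.eq_or_lt with hq | hq
  · refine P.not_lightlike hv (lt_of_le_of_ne h0 fun h => hne ?_) hq.symm
    have h1 := hq.symm
    simp only [lor, ← h, mul_zero, sub_zero] at h1
    exact Prod.ext h.symm (inner_self_eq_zero.1 h1)
  · obtain ⟨x₀, hx₀⟩ := P.solid
    set p := lor x₀.1 v with hp
    set q := lor v v
    have hr : 0 < p ^ 2 + q := by positivity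
    -- The nonnegative root of `q * s ^ 2 + 2 * p * s - 1`, where the ray from `x₀` in direction `v`
    -- crosses the light cone.
    set s := (-p + √(p ^ 2 + q)) / q with hs
    have hs0 : 0 ≤ s := by
      apply div_nonneg _ hq.le
      have : |p| ≤ √(p ^ 2 + q) := Real.abs_le_sqrt (by linarith)
      linarith [le_abs_self p]
    have hsq : s * q = -p + √(p ^ 2 + q) := by rw [hs]; field_simp
    refine P.not_lightlike (w := x₀.1 + s • v) (fun k => ?_)
      (add_pos_of_pos_of_nonneg x₀.2.2 (mul_nonneg hs0 h0)) ?_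
    · rw [lor_add_left, lor_smul_left]
      have := mul_nonpos_of_nonneg_of_nonpos hs0 (hv k)
      linarith [hx₀ k]
    · simp only [lor_add_left, lor_add_right, lor_smul_left, lor_smul_right, x₀.lor_self,
        lor_comm v x₀.1]
      have h1 := Real.sq_sqrt hr.le
      have h2 : √(p ^ 2 + q) = s * q + p := by linarith
      rw [h2] at h1
      have h3 : q * (2 * (s * p) + s * (s * q) - 1) = 0 := by linarith
      have h4 := (mul_eq_zero.1 h3).resolve_left hq.ne'
      linarith

variable {P}

theorem supp_eq_of_smul {x : Hyp n} {v : LVec n} {c : ℝ} (hc : 0 < c) (h : x.1 = c • v) :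
    P.supp x = {i | lor v (P.normal i) = 0} := by
  ext i
  simp [supp, h, lor_smul_left, hc.ne']

theorem mem_body_of_smul {x : Hyp n} {v : LVec n} {c : ℝ} (hc : 0 < c) (h : x.1 = c • v)
    (hv : ∀ k, lor v (P.normal k) ≤ 0) : x ∈ P.body := fun k => by
  rw [h, lor_smul_left]
  exact mul_nonpos_of_nonneg_of_nonpos hc.le (hv k)

theorem mem_facet_iff {x : Hyp n} {i : ι} : x ∈ P.facet i ↔ x ∈ P.body ∧ i ∈ P.supp x := Iff.rfl

/-- The labels of the facets that contain a face. -/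
def facetsOf (C : P.Face) : Set ι := {i | C.1 ⊆ P.facet i}

theorem mem_face_iff (C : P.Face) {x : Hyp n} :
    x ∈ C.1 ↔ x ∈ P.body ∧ P.facetsOf C ⊆ P.supp x := by
  obtain ⟨C, ⟨c, hc⟩, S, rfl⟩ := C
  constructor
  · intro hx
    exact ⟨hx.1, fun i hi => (hi hx).2⟩
  · rintro ⟨hx, h⟩
    exact ⟨hx, fun i hi => ⟨hx, h fun y hy => hy.2 i hi⟩⟩

theorem le_iff_facetsOf {C D : P.Face} : C ≤ D ↔ P.facetsOf D ⊆ P.facetsOf C := by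
  constructor
  · intro h i hi
    exact Set.Subset.trans h hi
  · intro h x hx
    rw [mem_face_iff] at hx ⊢
    exact ⟨hx.1, h.trans hx.2⟩

theorem facetsOf_injective : Function.Injective (P.facetsOf) := fun _ _ h =>
  le_antisymm (le_iff_facetsOf.2 h.ge) (le_iff_facetsOf.2 h.le)

theorem finite_face : Finite P.Face :=
  have := P.finite_facets
  Finite.of_injective _ facetsOf_injective

/-- The smallest face that contains a point. -/
def minFace (x : P.body) : P.Face :=
  ⟨{y | y ∈ P.body ∧ ∀ i ∈ P.supp x.1, y ∈ P.facet i}, ⟨x.1, x.2, fun _ hi => ⟨x.2, hi⟩⟩, _, rfl⟩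

theorem facetsOf_minFace (x : P.body) : P.facetsOf (minFace x) = P.supp x.1 := by
  ext i
  constructor
  · intro h
    exact (h (a := x.1) ⟨x.2, fun _ hi => ⟨x.2, hi⟩⟩).2
  · intro hi y hy
    exact hy.2 i hi

/-- The facet with a given label, as a face. -/
def facetFace (i : ι) : P.Face :=
  ⟨P.facet i, P.facet_nonempty i, {i}, by ext x; simp [mem_facet_iff]⟩

theorem le_facetFace_iff {C : P.Face} {i : ι} : C ≤ facetFace i ↔ i ∈ P.facetsOf C := Iff.rfl

theorem facetFace_injective : Function.Injective (facetFace (P := P)) := by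
  intro i j h
  by_contra hij
  obtain ⟨x, hx, h'⟩ := P.irredundant i
  have hxb : x ∈ P.body := fun k => by
    by_cases hk : k = i
    · rw [hk, hx]
    · exact (h' k hk).le
  have : x ∈ P.facet j := by
    have : x ∈ (facetFace (P := P) i).1 := ⟨hxb, hx⟩
    rwa [h] at this
  exact (h' j (Ne.symm hij)).ne this.2

/-- Add up points of `C`, one lying off each facet that does not contain `C`. The extra summand `c`
keeps the sum nonempty even without facets. -/
theorem exists_barycenter (C : P.Face) : ∃ b : Hyp n, b ∈ P.body ∧ P.supp b = P.facetsOf C := by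
  classical
  have := P.finite_facets
  have := Fintype.ofFinite ι
  obtain ⟨c, hc⟩ := C.2.1
  have h : ∀ j, ∃ x ∈ C.1, j ∉ P.facetsOf C → lor x.1 (P.normal j) < 0 := by
    intro j
    by_cases hj : j ∈ P.facetsOf C
    · exact ⟨c, hc, fun h => absurd hj h⟩
    · obtain ⟨x, hx, hxj⟩ := Set.not_subset.1 hj
      have hxb := ((mem_face_iff C).1 hx).1
      exact ⟨x, hx, fun _ => lt_of_le_of_ne (hxb j) fun h => hxj ⟨hxb, h⟩⟩
  choose x hx hneg using h
  let b : Option ι → Hyp n := fun o => o.elim c x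
  have hb : ∀ o, b o ∈ C.1 := fun o => by cases o; exacts [hc, hx _]
  have hlt := norm_lt_sum_smul Finset.univ (fun _ => (1 : ℝ)) b (by simp) (by
    rw [Finset.sum_const, Finset.card_univ, nsmul_one, Nat.cast_pos]
    exact Fintype.card_pos)
  simp only [one_smul] at hlt
  obtain ⟨a, ha, hv⟩ := hypNormalize_eq _ (lor_neg_of_norm_lt hlt) ((norm_nonneg _).trans_lt hlt)
  have hnp : ∀ k o, lor (b o).1 (P.normal k) ≤ 0 := fun k o => ((mem_face_iff C).1 (hb o)).1 k
  refine ⟨_, mem_body_of_smul ha hv fun k => ?_, ?_⟩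
  · rw [lor_sum_left]
    exact Finset.sum_nonpos fun o _ => hnp k o
  · rw [supp_eq_of_smul ha hv]
    ext i
    rw [Set.mem_ofPred_eq, lor_sum_left, Finset.sum_eq_zero_iff_of_nonpos fun o _ => hnp i o]
    constructor
    · intro h0
      by_contra hi
      exact (hneg i hi).ne (h0 (some i) (Finset.mem_univ _))
    · intro hi o _
      exact ((mem_face_iff C).1 (hb o)).2 hi

/-- A point in the relative interior of a face. -/
noncomputable def bary (C : P.Face) : Hyp n := (exists_barycenter C).choose

theorem bary_mem_body (C : P.Face) : bary C ∈ P.body := (exists_barycenter C).choose_spec.1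

theorem supp_bary (C : P.Face) : P.supp (bary C) = P.facetsOf C :=
  (exists_barycenter C).choose_spec.2

/-- The faces with nonzero weight form a chain. -/
def ChainSupported (t : P.Face → ℝ) : Prop := ∀ C D, C ≤ D ∨ D ≤ C ∨ t C * t D = 0

theorem ChainSupported.smul {t : P.Face → ℝ} (h : ChainSupported t) (c : ℝ) :
    ChainSupported (c • t) := fun C D => by
  rcases h C D with h | h | h
  · exact Or.inl h
  · exact Or.inr (Or.inl h)
  · refine Or.inr (Or.inr ?_)
    simp only [Pi.smul_apply, smul_eq_mul]
    linear_combination c ^ 2 * h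

section Barycentric

variable [Fintype P.Face]

/-- The vector with given barycentric weights. -/
noncomputable def baryVec (t : P.Face → ℝ) : LVec n := ∑ C, t C • (bary C).1

theorem lor_baryVec (t : P.Face → ℝ) (i : ι) :
    lor (baryVec t) (P.normal i) = ∑ C, t C * lor (bary C).1 (P.normal i) := by
  rw [baryVec, lor_sum_left]
  simp only [lor_smul_left]

theorem lor_baryVec_nonpos {t : P.Face → ℝ} (ht : ∀ C, 0 ≤ t C) (i : ι) :
    lor (baryVec t) (P.normal i) ≤ 0 := by
  rw [lor_baryVec]
  exact Finset.sum_nonpos fun C _ => mul_nonpos_of_nonneg_of_nonpos (ht C) (bary_mem_body C i)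

theorem lor_baryVec_eq_zero_iff {t : P.Face → ℝ} (ht : ∀ C, 0 ≤ t C) (i : ι) :
    lor (baryVec t) (P.normal i) = 0 ↔ ∀ C, t C ≠ 0 → i ∈ P.facetsOf C := by
  rw [lor_baryVec, Finset.sum_eq_zero_iff_of_nonpos fun C _ =>
    mul_nonpos_of_nonneg_of_nonpos (ht C) (bary_mem_body C i)]
  refine forall_congr' fun C => ?_
  rw [← supp_bary]
  simp only [Finset.mem_univ, true_imp_iff, mul_eq_zero, supp, Set.mem_ofPred_eq]
  tauto

theorem ChainSupported.exists_top {t : P.Face → ℝ} (h : ChainSupported t) (hne : t ≠ 0) :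
    ∃ C, t C ≠ 0 ∧ ∀ D, t D ≠ 0 → D ≤ C := by
  classical
  obtain ⟨C₀, hC₀⟩ := Function.ne_iff.1 hne
  obtain ⟨C, hC⟩ := (Finset.univ.filter fun C => t C ≠ 0).exists_maximal
    ⟨C₀, by simpa using hC₀⟩
  have h1 : t C ≠ 0 := by simpa using hC.prop
  refine ⟨C, h1, fun D hD => ?_⟩
  rcases h C D with h2 | h2 | h2
  · exact hC.le_of_ge (by simpa using hD) h2
  · exact h2
  · exact absurd h2 (mul_ne_zero h1 hD)

/-- The vector alone determines the largest face of the chain, which makes peeling off top faces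
possible. -/
theorem facetsOf_top {t : P.Face → ℝ} (ht : ∀ C, 0 ≤ t C) {C : P.Face} (hC : t C ≠ 0)
    (htop : ∀ D, t D ≠ 0 → D ≤ C) :
    P.facetsOf C = {i | lor (baryVec t) (P.normal i) = 0} := by
  ext i
  rw [Set.mem_ofPred_eq, lor_baryVec_eq_zero_iff ht]
  exact ⟨fun hi D hD => le_iff_facetsOf.1 (htop D hD) hi, fun h => h C hC⟩

theorem fst_baryVec_pos {t : P.Face → ℝ} (ht : ∀ C, 0 ≤ t C) (hne : t ≠ 0) :
    ‖(baryVec t).2‖ < (baryVec t).1 := by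
  refine norm_lt_sum_smul _ _ _ (fun C _ => ht C) ?_
  obtain ⟨C, hC⟩ := Function.ne_iff.1 hne
  exact Finset.sum_pos' (fun C _ => ht C) ⟨C, Finset.mem_univ _, lt_of_le_of_ne (ht C) hC.symm⟩

theorem baryVec_sub_single [DecidableEq P.Face] (t : P.Face → ℝ) (C : P.Face) (c : ℝ) :
    baryVec (t - Pi.single C c) = baryVec t - c • (bary C).1 := by
  simp only [baryVec, Pi.sub_apply, sub_smul, Finset.sum_sub_distrib]
  congr 1
  rw [Finset.sum_eq_single C]
  · rw [Pi.single_eq_same]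
  · intro D _ hD
    rw [Pi.single_eq_of_ne hD, zero_smul]
  · simp

/-- Barycentric weights supported on chains are unique. -/
theorem baryVec_injective (N : ℕ) {t t' : P.Face → ℝ}
    (hN : {C | t C ≠ 0}.ncard + {C | t' C ≠ 0}.ncard ≤ N) (ht : ∀ C, 0 ≤ t C)
    (ht' : ∀ C, 0 ≤ t' C) (hc : ChainSupported t) (hc' : ChainSupported t')
    (h : baryVec t = baryVec t') : t = t' := by
  classical
  have h0 : baryVec (0 : P.Face → ℝ) = 0 := by simp [baryVec]
  induction N generalizing t t' with
  | zero =>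
    have h1 : ∀ s : P.Face → ℝ, {C | s C ≠ 0}.ncard = 0 → s = 0 := fun s hs => by
      rw [Set.ncard_eq_zero] at hs
      ext C
      by_contra hC
      exact Set.eq_empty_iff_forall_notMem.1 hs C hC
    rw [h1 t (by omega), h1 t' (by omega)]
  | succ N ih =>
    by_cases e : t = 0
    · by_contra e'
      have h2 := fst_baryVec_pos ht' (fun h' => e' (e.trans h'.symm))
      rw [← h, e, h0] at h2
      simp at h2
    by_cases e' : t' = 0
    · have h2 := fst_baryVec_pos ht e
      rw [h, e', h0] at h2
      simp at h2
    obtain ⟨C, hC, htop⟩ := hc.exists_top e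
    obtain ⟨C', hC', htop'⟩ := hc'.exists_top e'
    have hCC : C = C' := facetsOf_injective (by
      rw [facetsOf_top ht hC htop, facetsOf_top ht' hC' htop', h])
    subst hCC
    -- Subtracting the smaller of the two top weights from both sides preserves the equation and
    -- removes `C` from at least one support.
    set c := min (t C) (t' C) with hcdef
    have hsub : ∀ s : P.Face → ℝ, s C ≠ 0 → {D | (s - Pi.single C c : P.Face → ℝ) D ≠ 0} ⊆ {D | s D ≠ 0} := by
      intro s hs D hD
      by_cases hDC : D = C
      · rwa [hDC]
      · simpa [Pi.single_eq_of_ne hDC] using hD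
    have hnn : ∀ s : P.Face → ℝ, (∀ D, 0 ≤ s D) → c ≤ s C → ∀ D, 0 ≤ (s - Pi.single C c : P.Face → ℝ) D := by
      intro s hs hsc D
      by_cases hDC : D = C
      · subst hDC
        simpa using hsc
      · simpa [Pi.single_eq_of_ne hDC] using hs D
    have hch : ∀ s : P.Face → ℝ, s C ≠ 0 → ChainSupported s →
        ChainSupported (s - Pi.single C c) := by
      intro s hs hsc D E
      rcases hsc D E with h1 | h1 | h1
      · exact Or.inl h1
      · exact Or.inr (Or.inl h1)
      · refine Or.inr (Or.inr ?_)
        by_contra hne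
        have h2 := hsub s hs (mul_ne_zero_iff.1 hne).1
        have h3 := hsub s hs (mul_ne_zero_iff.1 hne).2
        exact mul_ne_zero h2 h3 h1
    have hlt : ∀ s : P.Face → ℝ, s C ≠ 0 → c = s C →
        {D | (s - Pi.single C c : P.Face → ℝ) D ≠ 0}.ncard < {D | s D ≠ 0}.ncard := by
      intro s hs hsc
      apply Set.ncard_lt_ncard _ (Set.toFinite _)
      refine ⟨hsub s hs, fun h1 => ?_⟩
      have := h1 hs
      simp [hsc] at this
    have hle : ∀ s : P.Face → ℝ, s C ≠ 0 →
        {D | (s - Pi.single C c : P.Face → ℝ) D ≠ 0}.ncard ≤ {D | s D ≠ 0}.ncard := fun s hs =>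
      Set.ncard_le_ncard (hsub s hs) (Set.toFinite _)
    have hN' : {D | (t - Pi.single C c : P.Face → ℝ) D ≠ 0}.ncard +
        {D | (t' - Pi.single C c : P.Face → ℝ) D ≠ 0}.ncard ≤ N := by
      rcases min_choice (t C) (t' C) with h1 | h1
      · have := hlt t hC h1
        have := hle t' hC'
        omega
      · have := hlt t' hC' h1
        have := hle t hC
        omega
    have := ih hN' (hnn t ht (min_le_left _ _)) (hnn t' ht' (min_le_right _ _)) (hch t hC hc)
      (hch t' hC' hc') (by rw [baryVec_sub_single, baryVec_sub_single, h])
    exact sub_left_injective this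

theorem baryVec_add_single [DecidableEq P.Face] (t : P.Face → ℝ) (C : P.Face) (c : ℝ) :
    baryVec (t + Pi.single C c) = baryVec t + c • (bary C).1 := by
  have := baryVec_sub_single t C (-c)
  rwa [Pi.single_neg, sub_neg_eq_add, neg_smul, sub_neg_eq_add] at this

theorem baryVec_smul (c : ℝ) (t : P.Face → ℝ) : baryVec (c • t) = c • baryVec t := by
  simp only [baryVec, Pi.smul_apply, smul_eq_mul, mul_smul, Finset.smul_sum]

/-- Every point of the polytope is given by barycentric weights supported on a chain. -/
theorem exists_baryVec_eq (N : ℕ) {x : Hyp n} (hx : x ∈ P.body)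
    (hN : (P.supp x)ᶜ.ncard = N) :
    ∃ t : P.Face → ℝ, (∀ C, 0 ≤ t C) ∧ ChainSupported t ∧
      (∀ C, t C ≠ 0 → P.supp x ⊆ P.facetsOf C) ∧ baryVec t = x.1 := by
  classical
  have := P.finite_facets
  induction N using Nat.strong_induction_on generalizing x with
  | _ N ih =>
  set C := minFace (⟨x, hx⟩ : P.body) with hC
  have hCx : P.facetsOf C = P.supp x := facetsOf_minFace _
  set b := bary C with hb
  have hbx : P.supp b = P.supp x := (supp_bary C).trans hCx
  have hbb : b ∈ P.body := bary_mem_body C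
  have hzero : baryVec (0 : P.Face → ℝ) = 0 := by simp [baryVec]
  by_cases hxb : x = b
  · refine ⟨0 + Pi.single C 1, fun D => ?_, fun D E => ?_, fun D hD => ?_, ?_⟩
    · rw [zero_add]
      exact (Pi.single_nonneg.2 zero_le_one : (0 : P.Face → ℝ) ≤ Pi.single C 1) D
    · by_cases hD : D = C
      · by_cases hE : E = C
        · exact Or.inl (hD.trans hE.symm).le
        · simp [Pi.single_eq_of_ne hE]
      · simp [Pi.single_eq_of_ne hD]
    · by_cases hDC : D = C
      · rw [hDC, hCx]
      · simp [Pi.single_eq_of_ne hDC] at hD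
    · rw [baryVec_add_single, hzero, zero_add, one_smul, hxb]
  -- Project `x` from the barycenter `b` of its minimal face to the boundary of that face. At
  -- parameter `r` the time coordinate of `x - r • b` vanishes, so the ray has left the cone by
  -- then.
  · set r := x.1.1 / b.1.1 with hr
    have hrb : x.1.1 - r * b.1.1 = 0 := by
      have := b.2.2.ne'
      rw [hr]; field_simp; ring
    obtain ⟨k, hk⟩ : ∃ k, 0 < lor (x.1 - r • b.1) (P.normal k) := by
      by_contra! hcon
      have := P.norm_lt_of_mem_cone hcon (by simp [hrb]) fun h0 =>
        hxb (Hyp.eq_of_smul_eq (sub_eq_zero.1 h0))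
      have h1 : (x.1 - r • b.1).1 = 0 := by simp [hrb]
      rw [h1] at this
      exact absurd this (not_lt.2 (norm_nonneg _))
    have hsx : ∀ i, lor b.1 (P.normal i) = 0 ↔ lor x.1 (P.normal i) = 0 := fun i =>
      Set.ext_iff.1 hbx i
    have hkK : lor b.1 (P.normal k) < 0 := lt_of_le_of_ne (hbb k) fun h0 => by
      rw [lor_sub_left, lor_smul_left, h0, (hsx k).1 h0] at hk
      simp at hk
    -- The smallest ratio `t₀` gives the first wall hit. The normalized point `y` lies on all facets
    -- through `x` and also on `j`, so induction applies to `y`, whose chain lies below `C`.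
    obtain ⟨j, hj, hmin⟩ := Set.exists_min_image {i | lor b.1 (P.normal i) < 0}
      (fun i => lor x.1 (P.normal i) / lor b.1 (P.normal i)) (Set.toFinite _) ⟨k, hkK⟩
    set t₀ := lor x.1 (P.normal j) / lor b.1 (P.normal j) with ht₀
    have hj : lor b.1 (P.normal j) < 0 := hj
    have ht₀0 : 0 ≤ t₀ := div_nonneg_of_nonpos (hx j) hj.le
    have htr : t₀ < r := by
      refine (hmin k hkK).trans_lt ?_
      rw [lor_sub_left, lor_smul_left] at hk
      rw [div_lt_iff_of_neg hkK]
      linarith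
    have hw0 : 0 < (x.1 - t₀ • b.1).1 := by
      have := mul_lt_mul_of_pos_right htr b.2.2
      simp only [Prod.fst_sub, Prod.smul_fst, smul_eq_mul]
      linarith
    have hw : ∀ i, lor (x.1 - t₀ • b.1) (P.normal i) ≤ 0 := by
      intro i
      rw [lor_sub_left, lor_smul_left]
      rcases (hbb i).eq_or_lt with h0 | h0
      · rw [h0, (hsx i).1 h0]; simp
      · have := hmin i h0
        rw [le_div_iff_of_neg h0] at this
        linarith
    have hwlt := P.norm_lt_of_mem_cone hw hw0.le fun h => by simp [h] at hw0
    obtain ⟨c, hc, hy⟩ := hypNormalize_eq _ (lor_neg_of_norm_lt hwlt) hw0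
    set y := hypNormalize _ (lor_neg_of_norm_lt hwlt) hw0
    have hyb : y ∈ P.body := mem_body_of_smul hc hy hw
    have hys := supp_eq_of_smul (P := P) hc hy
    have hxy : P.supp x ⊆ P.supp y := fun i hi => by
      have hi : lor x.1 (P.normal i) = 0 := hi
      rw [hys, Set.mem_ofPred_eq, lor_sub_left, lor_smul_left, hi, (hsx i).2 hi]
      simp
    have hjy : j ∈ P.supp y := by
      rw [hys, Set.mem_ofPred_eq, lor_sub_left, lor_smul_left, ht₀, div_mul_cancel₀ _ hj.ne,
        sub_self]
    have hlt : (P.supp y)ᶜ.ncard < N := by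
      rw [← hN]
      apply Set.ncard_lt_ncard _ (Set.toFinite _)
      refine ⟨Set.compl_subset_compl.2 hxy, fun h => ?_⟩
      exact hj.ne ((hsx j).2 (Set.compl_subset_compl.1 h hjy))
    obtain ⟨t, ht, htc, hts, hty⟩ := ih _ hlt hyb rfl
    have htC : ∀ D, t D ≠ 0 → D ≤ C := fun D hD =>
      le_iff_facetsOf.2 (by rw [hCx]; exact hxy.trans (hts D hD))
    refine ⟨c⁻¹ • t + Pi.single C t₀, fun D => ?_, fun D E => ?_, fun D hD => ?_, ?_⟩
    · refine add_nonneg (mul_nonneg (inv_nonneg.2 hc.le) (ht D)) ?_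
      exact (Pi.single_nonneg.2 ht₀0 : (0 : P.Face → ℝ) ≤ Pi.single C t₀) D
    · by_cases hD : t D = 0
      · by_cases hDC : D = C
        · by_cases hE : t E = 0
          · by_cases hEC : E = C
            · exact Or.inl (hDC.trans hEC.symm).le
            · simp [Pi.single_eq_of_ne hEC, hE]
          · exact Or.inr (Or.inl (hDC ▸ htC E hE))
        · simp [Pi.single_eq_of_ne hDC, hD]
      · by_cases hEC : E = C
        · exact Or.inl (hEC ▸ htC D hD)
        · by_cases hE : t E = 0
          · simp [Pi.single_eq_of_ne hEC, hE]
          · rcases htc D E with h | h | h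
            · exact Or.inl h
            · exact Or.inr (Or.inl h)
            · exact absurd h (mul_ne_zero hD hE)
    · by_cases hDC : D = C
      · rw [hDC, hCx]
      · have : t D ≠ 0 := fun h => by simp [Pi.single_eq_of_ne hDC, h] at hD
        exact hxy.trans (hts D this)
    · rw [baryVec_add_single, baryVec_smul, hty, hy, smul_smul, inv_mul_cancel₀ hc.ne', one_smul,
        sub_add_cancel]

variable (P) in
/-- The geometric realization of the order complex of the face poset. -/
abbrev OrderComplex : Type _ :=
  {t : P.Face → ℝ // t ∈ stdSimplex ℝ P.Face ∧ ChainSupported t}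

/-- Compactness makes the continuous bijection onto `P.body` a homeomorphism. -/
instance : CompactSpace (OrderComplex P) := by
  refine isCompact_iff_compactSpace.1 ((isCompact_stdSimplex ℝ P.Face).inter_right
    (t := {t | ChainSupported t}) ?_)
  simp only [ChainSupported, Set.ofPred_forall]
  refine isClosed_iInter fun C => isClosed_iInter fun D => ?_
  by_cases h : C ≤ D ∨ D ≤ C
  · have : {t : P.Face → ℝ | C ≤ D ∨ D ≤ C ∨ t C * t D = 0} = Set.univ := by
      ext t
      simp only [Set.mem_ofPred_eq, Set.mem_univ, iff_true]
      tauto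
    rw [this]
    exact isClosed_univ
  · have : {t : P.Face → ℝ | C ≤ D ∨ D ≤ C ∨ t C * t D = 0} = {t | t C * t D = 0} := by
      ext t
      simp only [Set.mem_ofPred_eq]
      tauto
    rw [this]
    exact isClosed_eq (by fun_prop) continuous_const

theorem OrderComplex.ne_zero (t : OrderComplex P) : t.1 ≠ 0 := fun h => by
  have := t.2.1.2
  simp [h] at this

theorem OrderComplex.norm_lt (t : OrderComplex P) : ‖(baryVec t.1).2‖ < (baryVec t.1).1 :=
  fst_baryVec_pos t.2.1.1 t.ne_zero

/-- The point of the polytope with given barycentric weights. -/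
noncomputable def OrderComplex.point (t : OrderComplex P) : P.body :=
  ⟨hypNormalize (baryVec t.1) (lor_neg_of_norm_lt t.norm_lt) ((norm_nonneg _).trans_lt t.norm_lt),
    let ⟨_, hc, h⟩ := hypNormalize_eq (baryVec t.1) (lor_neg_of_norm_lt t.norm_lt)
      ((norm_nonneg _).trans_lt t.norm_lt)
    mem_body_of_smul hc h (lor_baryVec_nonpos t.2.1.1)⟩

theorem OrderComplex.point_eq (t : OrderComplex P) :
    ∃ c : ℝ, 0 < c ∧ t.point.1.1 = c • baryVec t.1 :=
  hypNormalize_eq _ (lor_neg_of_norm_lt t.norm_lt) ((norm_nonneg _).trans_lt t.norm_lt)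

theorem OrderComplex.mem_supp_point (t : OrderComplex P) (i : ι) :
    i ∈ P.supp t.point.1 ↔ ∀ C, t.1 C ≠ 0 → i ∈ P.facetsOf C := by
  obtain ⟨c, hc, h⟩ := t.point_eq
  rw [supp_eq_of_smul hc h]
  exact lor_baryVec_eq_zero_iff t.2.1.1 i

theorem OrderComplex.continuous_point : Continuous (OrderComplex.point (P := P)) := by
  have h : Continuous fun t : OrderComplex P => baryVec t.1 := by
    have : Continuous fun t : OrderComplex P => t.1 := continuous_subtype_val
    have hC : ∀ C, Continuous fun t : OrderComplex P => t.1 C := fun C =>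
      (continuous_apply (A := fun _ : P.Face => ℝ) C).comp this
    exact continuous_finsetSum _ fun C _ => (hC C).fun_smul (continuous_const (y := (bary C).1))
  have h' : Continuous fun t : OrderComplex P =>
      (√(-lor (baryVec t.1) (baryVec t.1)))⁻¹ • baryVec t.1 := by
    refine Continuous.fun_smul ?_ h
    refine Continuous.inv₀ (Continuous.sqrt (h.lor h).neg) fun t => ?_
    have := lor_neg_of_norm_lt t.norm_lt
    exact (Real.sqrt_pos.2 (by linarith)).ne'
  exact continuous_induced_rng.2 (continuous_induced_rng.2 h')

theorem OrderComplex.point_bijective : Function.Bijective (OrderComplex.point (P := P)) := by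
  constructor
  · intro t t' h
    obtain ⟨c, hc, e⟩ := t.point_eq
    obtain ⟨c', hc', e'⟩ := t'.point_eq
    rw [← h, e] at e'
    have h1 : baryVec ((c' / c) • t'.1) = baryVec t.1 := by
      rw [baryVec_smul, div_eq_inv_mul, mul_smul, ← e', smul_smul, inv_mul_cancel₀ hc.ne', one_smul]
    have hcc : 0 < c' / c := div_pos hc' hc
    have h2 := baryVec_injective _ le_rfl (fun C => mul_nonneg hcc.le (t'.2.1.1 C)) t.2.1.1
      (t'.2.2.smul _) t.2.2 h1
    have h3 := t.2.1.2
    rw [← h2] at h3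
    -- Both families of weights sum to one, so the scale factor is one.
    simp only [← Finset.mul_sum, t'.2.1.2, mul_one] at h3
    refine Subtype.ext (h2.symm.trans ?_)
    rw [h3]
    exact one_smul ℝ t'.1
  · intro x
    obtain ⟨t, ht, htc, -, htx⟩ := exists_baryVec_eq _ x.2 rfl
    have hne : t ≠ 0 := fun h => by
      have h1 := x.1.2.2
      rw [← htx, h] at h1
      simp [baryVec] at h1
    have hs : 0 < ∑ C, t C := by
      obtain ⟨C, hC⟩ := Function.ne_iff.1 hne
      exact Finset.sum_pos' (fun C _ => ht C)
        ⟨C, Finset.mem_univ _, lt_of_le_of_ne (ht C) hC.symm⟩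
    set s := ∑ C, t C with hsdef
    let T : OrderComplex P := ⟨s⁻¹ • t, ⟨fun C => mul_nonneg (inv_nonneg.2 hs.le) (ht C), by
      simp only [Pi.smul_apply, smul_eq_mul, ← Finset.mul_sum, ← hsdef, inv_mul_cancel₀ hs.ne']⟩,
      htc.smul _⟩
    obtain ⟨c, hc, e⟩ := T.point_eq
    refine ⟨T, Subtype.ext (Hyp.eq_of_smul_eq (c := c * s⁻¹) ?_)⟩
    rw [e, baryVec_smul, htx, smul_smul]

/-- The polytope is homeomorphic to the order complex of its face poset. -/
noncomputable def orderComplexHomeo : OrderComplex P ≃ₜ P.body :=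
  Continuous.homeoOfEquivCompactToT2 (f := Equiv.ofBijective _ OrderComplex.point_bijective)
    OrderComplex.continuous_point

theorem orderComplexHomeo_apply (t : OrderComplex P) : orderComplexHomeo t = t.point := rfl

/-- An order automorphism of the face poset acts on the order complex. -/
noncomputable def OrderComplex.map (α : P.Face ≃o P.Face) (t : OrderComplex P) : OrderComplex P :=
  ⟨fun C => t.1 (α.symm C), ⟨fun C => t.2.1.1 _, by
    rw [← t.2.1.2]; exact Equiv.sum_comp α.symm.toEquiv t.1⟩, fun C D => by
    have := t.2.2 (α.symm C) (α.symm D)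
    simpa using this⟩

theorem OrderComplex.continuous_map (α : P.Face ≃o P.Face) :
    Continuous (OrderComplex.map α) := by
  have : Continuous fun t : OrderComplex P => t.1 := continuous_subtype_val
  exact Continuous.subtype_mk (continuous_pi fun C =>
    (continuous_apply (A := fun _ : P.Face => ℝ) (α.symm C)).comp this) _

/-- The homeomorphism of the order complex induced by an automorphism of the face poset. -/
noncomputable def OrderComplex.mapHomeo (α : P.Face ≃o P.Face) :
    OrderComplex P ≃ₜ OrderComplex P where
  toFun := OrderComplex.map α
  invFun := OrderComplex.map α.symm
  left_inv t := Subtype.ext (by funext C; simp [OrderComplex.map])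
  right_inv t := Subtype.ext (by funext C; simp [OrderComplex.map])
  continuous_toFun := OrderComplex.continuous_map α
  continuous_invFun := OrderComplex.continuous_map α.symm

end Barycentric

/-- Every combinatorial symmetry is realized by a homeomorphism of the polytope. -/
theorem exists_homeomorph (α : P.Face ≃o P.Face) (σ : ι → ι)
    (hα : ∀ i, α (facetFace i) = facetFace (σ i)) :
    ∃ f : P.body ≃ₜ P.body, ∀ x i, i ∈ P.supp x.1 ↔ σ i ∈ P.supp (f x).1 := by
  have := finite_face (P := P)
  have := Fintype.ofFinite P.Face
  refine ⟨orderComplexHomeo.symm.trans ((OrderComplex.mapHomeo α).trans orderComplexHomeo),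
    fun x i => ?_⟩
  obtain ⟨t, rfl⟩ := orderComplexHomeo.surjective x
  rw [Homeomorph.trans_apply, Homeomorph.trans_apply, Homeomorph.symm_apply_apply,
    orderComplexHomeo_apply, orderComplexHomeo_apply, OrderComplex.mem_supp_point,
    OrderComplex.mem_supp_point]
  have h : ∀ C : P.Face, i ∈ P.facetsOf C ↔ σ i ∈ P.facetsOf (α C) := fun C => by
    rw [← le_facetFace_iff, ← le_facetFace_iff, ← hα, OrderIso.le_iff_le]
  constructor
  · intro h1 C hC
    have := (h _).1 (h1 (α.symm C) hC)
    rwa [OrderIso.apply_symm_apply] at this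
  · intro h1 C hC
    refine (h C).2 (h1 (α C) ?_)
    change t.1 (α.symm (α C)) ≠ 0
    rwa [OrderIso.symm_apply_apply]

end RAPolytope

/-! ### Vertices and edges, connectedness of the edge graph, rigidity of the face poset. -/

namespace RAPolytope

variable {n : ℕ} {ι : Type*} {P : RAPolytope n ι}

theorem orthogonal_of_mem_supp {x : Hyp n} (hx : x ∈ P.body) {i k : ι} (hi : i ∈ P.supp x)
    (hk : k ∈ P.supp x) (hik : i ≠ k) : lor (P.normal i) (P.normal k) = 0 :=
  Meets.orthogonal ⟨x, ⟨hx, hi⟩, ⟨hx, hk⟩⟩ hik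

/-- A ray that starts inside the polytope leaves it through a new facet. -/
theorem exists_exit {x : Hyp n} (hx : x ∈ P.body) {r : LVec n} (hr : lor r r = 1)
    (hxr : lor x.1 r = 0) (hk : ∀ k ∈ P.supp x, lor r (P.normal k) ≤ 0) :
    ∃ (y : Hyp n) (t c : ℝ) (k : ι), y ∈ P.body ∧ 0 < t ∧ t < 1 ∧ 0 < c ∧
      y.1 = c • (x.1 + t • r) ∧ lor x.1 (P.normal k) < 0 ∧ 0 < lor r (P.normal k) ∧
      k ∈ P.supp y := by
  have := P.finite_facets
  have hrx : lor r x.1 = 0 := by rw [lor_comm, hxr]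
  have hself : ∀ t : ℝ, lor (x.1 + t • r) (x.1 + t • r) = t ^ 2 - 1 := fun t => by
    simp only [lor_add_left, lor_add_right, lor_smul_left, lor_smul_right, hr, hxr, hrx,
      x.lor_self]
    ring
  have hneg : ∀ t : ℝ, lor (x.1 + t • r) x.1 < 0 := fun t => by
    rw [lor_add_left, lor_smul_left, hrx, x.lor_self]; norm_num
  have hK : ∀ k, 0 < lor r (P.normal k) → lor x.1 (P.normal k) < 0 := fun k h =>
    lt_of_le_of_ne (hx k) fun h0 => absurd (hk k h0) (not_le.2 h)
  have hpos := fst_pos_of_lor_neg x (by rw [hself]; norm_num) (hneg 1)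
  -- At parameter one the vector is lightlike, hence outside the cone over the compact polytope; the
  -- ray therefore exits at some `t < 1`.
  obtain ⟨k, hk1⟩ : ∃ k, 0 < lor (x.1 + (1 : ℝ) • r) (P.normal k) := by
    by_contra! hcon
    have h1 := P.norm_lt_of_mem_cone hcon hpos.le fun h => by rw [h] at hpos; exact lt_irrefl _ hpos
    have h2 := lor_neg_of_norm_lt h1
    rw [hself] at h2
    norm_num at h2
  rw [lor_add_left, lor_smul_left, one_mul] at hk1
  have hk2 : 0 < lor r (P.normal k) := by linarith [hx k]
  obtain ⟨j, hj, hmin⟩ := Set.exists_min_image {i | 0 < lor r (P.normal i)}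
    (fun i => -lor x.1 (P.normal i) / lor r (P.normal i)) (Set.toFinite _) ⟨k, hk2⟩
  have hj : 0 < lor r (P.normal j) := hj
  set t := -lor x.1 (P.normal j) / lor r (P.normal j) with ht
  have ht0 : 0 < t := div_pos (by linarith [hK j hj]) hj
  have ht1 : t < 1 := (hmin k hk2).trans_lt ((div_lt_one hk2).2 (by linarith))
  have hlt : lor (x.1 + t • r) (x.1 + t • r) < 0 := by rw [hself]; nlinarith
  have h0 := fst_pos_of_lor_neg x hlt.le (hneg t)
  obtain ⟨c, hc, hy⟩ := hypNormalize_eq _ hlt h0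
  refine ⟨_, t, c, j, mem_body_of_smul hc hy fun i => ?_, ht0, ht1, hc, hy, hK j hj, hj, ?_⟩
  · rw [lor_add_left, lor_smul_left]
    by_cases hi : 0 < lor r (P.normal i)
    · have := hmin i hi
      rw [le_div_iff₀ hi] at this
      linarith
    · have := mul_nonpos_of_nonneg_of_nonpos ht0.le (not_lt.1 hi)
      linarith [hx i]
  · rw [supp_eq_of_smul hc hy, Set.mem_ofPred_eq, lor_add_left, lor_smul_left, ht,
      div_mul_cancel₀ _ hj.ne']
    ring

variable (P) in
/-- A vertex of the polytope: the facets through it span the tangent space. -/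
def IsVertex (v : Hyp n) : Prop :=
  v ∈ P.body ∧ ∀ r, lor r v.1 = 0 → (∀ k ∈ P.supp v, lor r (P.normal k) = 0) → r = 0

/-- If `x` is not a vertex, some direction is tangent to all facets through it; following it to the
exit adds a facet and keeps the old ones. -/
theorem exists_isVertex (N : ℕ) {x : Hyp n} (hx : x ∈ P.body) (hN : (P.supp x)ᶜ.ncard = N) :
    ∃ v, P.IsVertex v ∧ P.supp x ⊆ P.supp v := by
  have := P.finite_facets
  induction N using Nat.strong_induction_on generalizing x with
  | _ N ih =>
  by_cases hv : P.IsVertex x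
  · exact ⟨x, hv, subset_rfl⟩
  · rw [IsVertex, not_and] at hv
    have hv := hv hx
    push Not at hv
    obtain ⟨r, hrx, hrk, hr0⟩ := hv
    have hrr : 0 < lor r r := by
      by_contra h
      exact hr0 (eq_zero_of_orthogonal x hrx (not_lt.1 h))
    have hs := Real.sqrt_pos.2 hrr
    obtain ⟨y, t, c, k, hy, -, -, hc, hyv, hxk, -, hky⟩ := exists_exit hx
      (r := (√(lor r r))⁻¹ • r) (by
        rw [lor_smul_left, lor_smul_right, ← mul_assoc, ← mul_inv, Real.mul_self_sqrt hrr.le,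
          inv_mul_cancel₀ hrr.ne'])
      (by rw [lor_smul_right, lor_comm x.1 r, hrx, mul_zero])
      (fun k hk => by rw [lor_smul_left, hrk k hk, mul_zero])
    have hsub : P.supp x ⊆ P.supp y := fun i hi => by
      rw [supp_eq_of_smul hc hyv, Set.mem_ofPred_eq, lor_add_left, lor_smul_left, lor_smul_left,
        hrk i hi, show lor x.1 (P.normal i) = 0 from hi]
      ring
    have hlt : (P.supp y)ᶜ.ncard < N := by
      rw [← hN]
      apply Set.ncard_lt_ncard _ (Set.toFinite _)
      exact ⟨Set.compl_subset_compl.2 hsub, fun h => hxk.ne (Set.compl_subset_compl.1 h hky)⟩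
    obtain ⟨v, hv, h⟩ := ih _ hlt hy rfl
    exact ⟨v, hv, hsub.trans h⟩

-- A vertex and the unit normals of the facets through it are pairwise orthogonal and span, so this
-- is the expansion in a Lorentz-orthonormal basis.
open Classical in
theorem IsVertex.expansion [Fintype ι] {v : Hyp n} (hv : P.IsVertex v) (y : LVec n) :
    y = -lor y v.1 • v.1 +
      ∑ i ∈ Finset.univ.filter (· ∈ P.supp v), lor y (P.normal i) • P.normal i := by
  refine sub_eq_zero.1 (hv.2 _ ?_ fun k hk => ?_)
  · rw [lor_sub_left, lor_add_left, lor_smul_left, lor_sum_left, Finset.sum_eq_zero, v.lor_self]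
    · ring
    · intro i hi
      rw [lor_smul_left, lor_comm (P.normal i) v.1,
        show lor v.1 (P.normal i) = 0 from (Finset.mem_filter.1 hi).2,
        mul_zero]
  · rw [lor_sub_left, lor_add_left, lor_smul_left, lor_sum_left, Finset.sum_eq_single k]
    · rw [lor_smul_left, P.unit, show lor v.1 (P.normal k) = 0 from hk]; ring
    · intro i hi hik
      rw [lor_smul_left, orthogonal_of_mem_supp hv.1 (Finset.mem_filter.1 hi).2 hk hik, mul_zero]
    · intro h
      exact absurd (Finset.mem_filter.2 ⟨Finset.mem_univ k, hk⟩) h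

theorem IsVertex.eq_of_supp_subset {v w : Hyp n} (hv : P.IsVertex v)
    (h : P.supp v ⊆ P.supp w) : w = v := by
  have h1 : w.1 - (-lor w.1 v.1) • v.1 = 0 := by
    refine hv.2 _ ?_ fun k hk => ?_
    · rw [lor_sub_left, lor_smul_left, v.lor_self]; ring
    · rw [lor_sub_left, lor_smul_left, show lor v.1 (P.normal k) = 0 from hk,
        show lor w.1 (P.normal k) = 0 from h hk]
      ring
  exact Hyp.eq_of_smul_eq (sub_eq_zero.1 h1)

variable (P) in
/-- `w` is the other end of the edge from `v` that leaves the facet `i` and ends at the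
facet `k`. -/
structure IsEdge (v w : Hyp n) (i k : ι) (t c : ℝ) : Prop where
  isVertex : P.IsVertex v
  mem : i ∈ P.supp v
  target : P.IsVertex w
  t_pos : 0 < t
  c_pos : 0 < c
  eq : w.1 = c • (v.1 - t • P.normal i)
  notMem : k ∉ P.supp v
  neg : lor (P.normal i) (P.normal k) < 0
  supp_eq : P.supp w = insert k (P.supp v \ {i})

/-- The direction `-normal i` is tangent to the other facets through `v` because of the right
angles; the edge runs along it to the exit point. -/
theorem IsVertex.exists_edge {v : Hyp n} (hv : P.IsVertex v) {i : ι} (hi : i ∈ P.supp v) :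
    ∃ w k t c, P.IsEdge v w i k t c := by
  have hvi : lor v.1 (P.normal i) = 0 := hi
  obtain ⟨w, t, c, k, hw, ht0, ht1, hc, hwv, hvk, hik, hkw⟩ := exists_exit hv.1
    (r := -P.normal i) (by rw [lor_neg_left, lor_neg_right, P.unit, neg_neg])
    (by rw [lor_neg_right, hvi, neg_zero]) (fun j hj => by
      rw [lor_neg_left]
      by_cases hij : i = j
      · rw [hij, P.unit]; norm_num
      · rw [orthogonal_of_mem_supp hv.1 hi hj hij, neg_zero])
  rw [lor_neg_left] at hik
  have hwv' : w.1 = c • (v.1 - t • P.normal i) := by rw [hwv]; module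
  have hsw := supp_eq_of_smul (P := P) hc hwv'
  have hk0 : lor v.1 (P.normal k) = t * lor (P.normal i) (P.normal k) := by
    rw [hsw, Set.mem_ofPred_eq, lor_sub_left, lor_smul_left] at hkw
    linarith
  have hiw : i ∉ P.supp w := by
    rw [hsw, Set.mem_ofPred_eq, lor_sub_left, lor_smul_left, hvi, P.unit]
    simpa using ht0.ne'
  have hsub : P.supp v \ {i} ⊆ P.supp w := fun j ⟨hj, hji⟩ => by
    rw [hsw, Set.mem_ofPred_eq, lor_sub_left, lor_smul_left, show lor v.1 (P.normal j) = 0 from hj,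
      orthogonal_of_mem_supp hv.1 hi hj (fun h => hji h.symm)]
    ring
  -- Used twice: it makes `w` a vertex, and it excludes further facets through `w`, since their
  -- normals would be orthogonal to all these vectors.
  have key : ∀ r, lor r w.1 = 0 → (∀ j ∈ P.supp v \ {i}, lor r (P.normal j) = 0) →
      lor r (P.normal k) = 0 → r = 0 := by
    intro r h1 h2 h3
    rw [hwv', lor_smul_right, lor_sub_right, lor_smul_right] at h1
    have h1 := (mul_eq_zero.1 h1).resolve_left hc.ne'
    set β := lor r (P.normal i) with hβ
    have h4 : r + (t * β) • v.1 - β • P.normal i = 0 := by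
      refine hv.2 _ ?_ fun j hj => ?_
      · simp only [lor_sub_left, lor_add_left, lor_smul_left, v.lor_self, lor_comm (P.normal i) v.1,
          hvi]
        linarith
      · have hvj : lor v.1 (P.normal j) = 0 := hj
        simp only [lor_sub_left, lor_add_left, lor_smul_left, hvj]
        by_cases hij : i = j
        · rw [← hij, P.unit, hβ]; ring
        · rw [orthogonal_of_mem_supp hv.1 hi hj hij, h2 j ⟨hj, fun h => hij h.symm⟩]; ring
    have h5 : r = β • P.normal i - (t * β) • v.1 := by
      rw [← sub_eq_zero, ← h4]; module
    have h6 : β * ((1 - t ^ 2) * lor (P.normal i) (P.normal k)) = 0 := by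
      have := h3
      rw [h5, lor_sub_left, lor_smul_left, lor_smul_left, hk0] at this
      linarith
    have h7 : β = 0 := by
      refine (mul_eq_zero.1 h6).resolve_right (mul_ne_zero ?_ ?_)
      · nlinarith
      · linarith
    rw [h5, h7]; simp
  have hwV : P.IsVertex w :=
    ⟨hw, fun r h1 h2 => key r h1 (fun j hj => h2 j (hsub hj)) (h2 k hkw)⟩
  refine ⟨w, k, t, c, hv, hi, hwV, ht0, hc, hwv', hvk.ne, by linarith, ?_⟩
  apply Set.Subset.antisymm
  · intro j hj
    by_contra hn
    rw [Set.mem_insert_iff, not_or] at hn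
    have h0 := key (P.normal j) (by rw [lor_comm]; exact hj) (fun l hl =>
      orthogonal_of_mem_supp hw hj (hsub hl) fun h => hn.2 (h ▸ hl))
      (orthogonal_of_mem_supp hw hj hkw hn.1)
    have := P.unit j
    rw [h0, lor_zero_left] at this
    norm_num at this
  · exact Set.insert_subset hkw hsub

/-- Only the facets through an end of an edge meet the edge. -/
theorem IsEdge.mem_of_mem_supp {v w : Hyp n} {i k : ι} {t c : ℝ} (h : P.IsEdge v w i k t c)
    {y : Hyp n} (hy : y ∈ P.body) (hsub : P.supp v \ {i} ⊆ P.supp y) {j : ι}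
    (hj : j ∈ P.supp y) : j ∈ insert k (P.supp v) := by
  have hvi : lor v.1 (P.normal i) = 0 := h.mem
  have hsw := supp_eq_of_smul (P := P) h.c_pos h.eq
  have hk0 : lor v.1 (P.normal k) = t * lor (P.normal i) (P.normal k) := by
    have : k ∈ P.supp w := by rw [h.supp_eq]; exact Set.mem_insert _ _
    rw [hsw, Set.mem_ofPred_eq, lor_sub_left, lor_smul_left] at this
    linarith
  -- The point `y` lies in the plane of `v` and `normal i`, which contains the edge.
  have hyv : y.1 - ((-lor y.1 v.1) • v.1 + lor y.1 (P.normal i) • P.normal i) = 0 := by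
    refine h.isVertex.2 _ ?_ fun l hl => ?_
    · simp only [lor_sub_left, lor_add_left, lor_smul_left, v.lor_self, lor_comm (P.normal i) v.1,
        hvi]
      ring
    · have hvl : lor v.1 (P.normal l) = 0 := hl
      simp only [lor_sub_left, lor_add_left, lor_smul_left, hvl]
      by_cases hil : i = l
      · rw [← hil, P.unit]; ring
      · rw [orthogonal_of_mem_supp h.isVertex.1 h.mem hl hil,
          show lor y.1 (P.normal l) = 0 from hsub ⟨hl, fun h => hil h.symm⟩]
        ring
  have ha := Hyp.lor_neg y v
  have hb := hy i
  have hyu : ∀ l, lor y.1 (P.normal l) = -lor y.1 v.1 * lor v.1 (P.normal l) +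
      lor y.1 (P.normal i) * lor (P.normal i) (P.normal l) := fun l => by
    conv_lhs => rw [sub_eq_zero.1 hyv]
    rw [lor_add_left, lor_smul_left, lor_smul_left]
  by_contra hn
  rw [Set.mem_insert_iff, not_or] at hn
  have hvj : lor v.1 (P.normal j) < 0 := lt_of_le_of_ne (h.isVertex.1 j) hn.2
  have hwj : lor v.1 (P.normal j) - t * lor (P.normal i) (P.normal j) < 0 := by
    have h1 : j ∉ P.supp w := by
      rw [h.supp_eq]
      rintro (h1 | h1)
      · exact hn.1 h1
      · exact hn.2 h1.1
    have h2 := h.target.1 j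
    rw [h.eq, lor_smul_left, lor_sub_left, lor_smul_left] at h2
    rw [hsw, Set.mem_ofPred_eq, lor_sub_left, lor_smul_left] at h1
    exact lt_of_le_of_ne (nonpos_of_mul_nonpos_right h2 h.c_pos) h1
  have e1 := hyu j
  rw [show lor y.1 (P.normal j) = 0 from hj] at e1
  have e2 := hyu k
  rw [hk0] at e2
  have e3 := hy k
  have hneg := h.neg
  have ht := h.t_pos
  generalize lor (P.normal i) (P.normal j) = p at *
  generalize lor (P.normal i) (P.normal k) = q at *
  generalize lor y.1 v.1 = a at *
  generalize lor y.1 (P.normal i) = b at *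
  generalize lor v.1 (P.normal j) = d at *
  -- This and `b ≤ 0` say that `y` is a nonnegative combination of `v` and `v - t • normal i`, the
  -- two ends of the edge up to scale. A wall missing both ends then misses `y`.
  have h4 : 0 ≤ -a * t + b := by
    by_contra h5
    have := mul_pos_of_neg_of_neg (not_le.1 h5) hneg
    linarith
  have h5 : b ≠ 0 := by
    rintro rfl
    have := mul_neg_of_pos_of_neg (neg_pos.2 ha) hvj
    linarith
  have h6 : b < 0 := lt_of_le_of_ne hb h5
  have h7 := mul_pos_of_neg_of_neg h6 hwj
  have h8 := mul_nonpos_of_nonneg_of_nonpos h4 hvj.le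
  have h9 : t * (-a * d + b * p) = 0 := by rw [← e1, mul_zero]
  linarith

open Classical in
/-- The simplex method: from any vertex other than a given one, some edge improves a functional
that is maximal at the given vertex. -/
theorem exists_improving_edge [Fintype ι] {v vs : Hyp n} (hv : P.IsVertex v)
    (hvs : P.IsVertex vs) (hne : v ≠ vs) :
    ∃ w i k t c, P.IsEdge v w i k t c ∧
      (∑ j ∈ Finset.univ.filter (· ∈ P.supp vs), lor v.1 (P.normal j)) / -lor v.1 vs.1 <
      (∑ j ∈ Finset.univ.filter (· ∈ P.supp vs), lor w.1 (P.normal j)) / -lor w.1 vs.1 := by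
  set A := Finset.univ.filter (· ∈ P.supp vs) with hA
  have hT : 0 < -lor v.1 vs.1 := neg_pos.2 (Hyp.lor_neg _ _)
  set h := (∑ j ∈ A, lor v.1 (P.normal j)) / -lor v.1 vs.1 with hh
  have hL : ∑ j ∈ A, lor v.1 (P.normal j) < 0 := by
    refine lt_of_le_of_ne (Finset.sum_nonpos fun j _ => hv.1 j) fun h0 => hne ?_
    rw [Finset.sum_eq_zero_iff_of_nonpos fun j _ => hv.1 j] at h0
    exact hvs.eq_of_supp_subset fun j hj => h0 j (by simpa [hA] using hj)
  have hh0 : h < 0 := div_neg_of_neg_of_pos hL hT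
  -- The quotient at `x` exceeds its value `h` at `v` exactly when `lor x q > 0`, so the form `q`
  -- linearizes the objective at level `h`.
  set q : LVec n := ∑ j ∈ A, P.normal j + h • vs.1 with hq
  have hlq : ∀ x, lor x q = ∑ j ∈ A, lor x (P.normal j) + h * lor x vs.1 := fun x => by
    rw [hq, lor_add_right, lor_smul_right, lor_sum_right]
  have hvq : lor v.1 q = 0 := by
    have : h * -lor v.1 vs.1 = _ := div_mul_cancel₀ _ hT.ne'
    rw [hlq]
    linarith
  have hvsq : 0 < lor vs.1 q := by
    have : ∑ j ∈ A, lor vs.1 (P.normal j) = 0 :=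
      Finset.sum_eq_zero fun j hj => (Finset.mem_filter.1 hj).2
    rw [hlq, vs.lor_self, this]
    linarith
  -- Expanded at `v`, the positive number `lor vs q` has a positive term. Its facet `i` satisfies
  -- `lor (normal i) q < 0`, so leaving `i` increases `q`.
  have hexp := congrArg (fun y => lor y q) (hv.expansion vs.1)
  simp only [lor_add_left, lor_smul_left, hvq, mul_zero, zero_add, lor_sum_left] at hexp
  rw [hexp] at hvsq
  obtain ⟨i, hi, hiq⟩ := Finset.exists_lt_of_sum_lt (s := Finset.univ.filter (· ∈ P.supp v))
    (f := fun _ => (0 : ℝ)) (by simpa using hvsq)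
  have hiq' : lor (P.normal i) q < 0 := by
    by_contra h1
    exact absurd (mul_nonpos_of_nonpos_of_nonneg (hvs.1 i) (not_lt.1 h1)) (not_le.2 hiq)
  obtain ⟨w, k, t, c, he⟩ := hv.exists_edge (Finset.mem_filter.1 hi).2
  refine ⟨w, i, k, t, c, he, ?_⟩
  have hwq : 0 < lor w.1 q := by
    rw [he.eq, lor_smul_left, lor_sub_left, lor_smul_left, hvq]
    have := mul_neg_of_pos_of_neg he.t_pos hiq'
    exact mul_pos he.c_pos (by linarith)
  rw [lt_div_iff₀ (neg_pos.2 (Hyp.lor_neg _ _))]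
  rw [hlq] at hwq
  linarith

/-- The graph of the polytope is connected. -/
theorem vertex_induction {p : Hyp n → Prop} {v : Hyp n} (hv : P.IsVertex v) (hp : p v)
    (step : ∀ v w i k t c, P.IsEdge v w i k t c → p v → p w) {vs : Hyp n} (hvs : P.IsVertex vs) :
    p vs := by
  classical
  have := P.finite_facets
  have := Fintype.ofFinite ι
  have hfin : {u | P.IsVertex u ∧ p u}.Finite := by
    refine Set.Finite.of_finite_image (f := P.supp) (Set.toFinite _) ?_
    intro u hu u' hu' h
    exact (hu.1.eq_of_supp_subset h.le).symm
  obtain ⟨u, hu, hmax⟩ := Set.exists_max_image _ (fun u : Hyp n =>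
    (∑ j ∈ Finset.univ.filter (· ∈ P.supp vs), lor u.1 (P.normal j)) / -lor u.1 vs.1) hfin
    ⟨v, hv, hp⟩
  by_cases hne : u = vs
  · exact hne ▸ hu.2
  · obtain ⟨w, i, k, t, c, he, hlt⟩ := exists_improving_edge hu.1 hvs hne
    exact absurd (hmax w ⟨he.target, step _ _ _ _ _ _ he hu.2⟩) (not_le.2 hlt)

/-- Every set of facets through a point cuts out a face contained in no other facet. -/
theorem exists_supp_eq {v : Hyp n} (hv : v ∈ P.body) {T : Set ι} (hT : T ⊆ P.supp v) :
    ∃ y ∈ P.body, P.supp y = T := by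
  classical
  have := P.finite_facets
  have := Fintype.ofFinite ι
  set A := Finset.univ.filter (· ∈ P.supp v \ T) with hA
  -- Moving against the normals of the unwanted facets leaves exactly these; orthogonality keeps the
  -- point on the facets of `T`.
  set r : LVec n := -∑ k ∈ A, P.normal k with hr
  have hr1 : ∀ j ∈ T, lor r (P.normal j) = 0 := by
    intro j hj
    rw [hr, lor_neg_left, lor_sum_left, Finset.sum_eq_zero, neg_zero]
    intro k hk
    have hk : k ∈ P.supp v \ T := by simpa [hA] using hk
    exact orthogonal_of_mem_supp hv hk.1 (hT hj) fun h => hk.2 (h ▸ hj)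
  have hr2 : ∀ j ∈ P.supp v \ T, lor r (P.normal j) = -1 := by
    intro j hj
    rw [hr, lor_neg_left, lor_sum_left, Finset.sum_eq_single j, P.unit]
    · intro k hk hkj
      have hk : k ∈ P.supp v \ T := by simpa [hA] using hk
      exact orthogonal_of_mem_supp hv hk.1 hj.1 hkj
    · intro h
      exact absurd (by simpa [hA] using hj) h
  obtain ⟨t, ht0, ht1, ht2⟩ := (eventually_mem_nhdsWithin.and
    (((eventually_future v r).filter_mono (nhdsWithin_le_nhds (s := Set.Ioi (0 : ℝ)))).and
    ((P.eventually_lor_neg v r).filter_mono nhdsWithin_le_nhds))).exists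
  have ht0 : 0 < t := ht0
  obtain ⟨c, hc, hy⟩ := hypNormalize_eq _ (lor_neg_of_norm_lt ht1) ((norm_nonneg _).trans_lt ht1)
  have hk : ∀ k, (k ∈ T → lor (v.1 + t • r) (P.normal k) = 0) ∧
      (k ∉ T → lor (v.1 + t • r) (P.normal k) < 0) := by
    intro k
    refine ⟨fun hk => ?_, fun hk => ?_⟩
    · rw [lor_add_left, lor_smul_left, hr1 k hk, show lor v.1 (P.normal k) = 0 from hT hk]; ring
    · by_cases hkv : k ∈ P.supp v
      · rw [lor_add_left, lor_smul_left, hr2 k ⟨hkv, hk⟩, show lor v.1 (P.normal k) = 0 from hkv]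
        linarith
      · exact ht2 k (lt_of_le_of_ne (hv k) hkv)
  refine ⟨_, mem_body_of_smul hc hy fun k => ?_, ?_⟩
  · by_cases h : k ∈ T
    · exact ((hk k).1 h).le
    · exact ((hk k).2 h).le
  · rw [supp_eq_of_smul hc hy]
    ext k
    refine ⟨fun h => ?_, fun h => (hk k).1 h⟩
    by_contra hn
    exact ((hk k).2 hn).ne h

/-- An automorphism of the face poset that fixes all faces of one facet fixes all facets. -/
theorem automorphism_rigid (τ : P.Face ≃o P.Face) (π : ι → ι)
    (hπ : ∀ j, τ (facetFace j) = facetFace (π j)) {i : ι}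
    (hi : ∀ C ≤ facetFace i, τ C = C) (j : ι) : π j = j := by
  have hinj : Function.Injective π := fun j k h =>
    facetFace_injective (τ.injective (by rw [hπ, hπ, h]))
  have hmem : ∀ {C : P.Face} {j : ι}, j ∈ P.facetsOf C → π j ∈ P.facetsOf (τ C) := by
    intro C j hj
    rw [← le_facetFace_iff] at hj ⊢
    rw [← hπ]
    exact τ.monotone hj
  have hii : π i = i := facetFace_injective (by rw [← hπ, hi _ le_rfl])
  have hfix : ∀ v, P.IsVertex v → ∀ j ∈ P.supp v, π j = j := by
    obtain ⟨x, hx⟩ := P.facet_nonempty i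
    obtain ⟨v₀, hv₀, hsub⟩ := exists_isVertex _ hx.1 rfl
    have hi₀ : i ∈ P.supp v₀ := hsub hx.2
    intro vs hvs
    refine vertex_induction (p := fun v => ∀ j ∈ P.supp v, π j = j) hv₀ ?_ ?_ hvs
    -- At a vertex of facet `i`, the face lying in exactly the facets `i` and `j` is fixed, so `π j`
    -- is `i` or `j`; injectivity leaves `j`.
    · intro j hj
      obtain ⟨y, hy, hys⟩ := exists_supp_eq hv₀.1 (T := {i, j})
        (Set.insert_subset hi₀ (Set.singleton_subset_iff.2 hj))
      set E : P.Face := minFace ⟨y, hy⟩ with hE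
      have hEs : P.facetsOf E = {i, j} := (facetsOf_minFace _).trans hys
      have hτE : τ E = E := hi E (by rw [le_facetFace_iff, hEs]; exact Set.mem_insert _ _)
      have h1 : π j ∈ P.facetsOf (τ E) := hmem (by rw [hEs]; exact Or.inr rfl)
      rw [hτE, hEs] at h1
      rcases h1 with h1 | h1
      · rw [h1]
        exact hinj (hii.trans h1.symm)
      · exact h1
    · intro v w i' k t c he hfv j hj
      rw [he.supp_eq] at hj
      rcases hj with rfl | hj
      -- The image of the far vertex lies on the line of the edge, so the image of the new facet is
      -- that facet or one through `v`. The latter are fixed already, and injectivity concludes.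
      · have hTw : P.supp v \ {i'} ⊆ P.supp w := by rw [he.supp_eq]; exact Set.subset_insert _ _
        have hjw : j ∈ P.supp w := by rw [he.supp_eq]; exact Set.mem_insert _ _
        set D : P.Face := minFace ⟨w, he.target.1⟩ with hD
        have hDs : P.facetsOf D = P.supp w := facetsOf_minFace _
        obtain ⟨y, hy⟩ := (τ D).2.1
        rw [mem_face_iff] at hy
        have h1 : P.supp v \ {i'} ⊆ P.supp y := fun l hl => by
          rw [← hfv l hl.1]
          exact hy.2 (hmem (by rw [hDs]; exact hTw hl))
        have h2 := he.mem_of_mem_supp hy.1 h1 (hy.2 (hmem (by rw [hDs]; exact hjw)))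
        rcases h2 with h2 | h2
        · exact h2
        · exact hinj (hfv _ h2)
      · exact hfv j hj.1
  obtain ⟨x, hx⟩ := P.facet_nonempty j
  obtain ⟨v, hv, hsub⟩ := exists_isVertex _ hx.1 rfl
  exact hfix v hv j (hsub hx.2)

end RAPolytope

/-! ### Cells of small covers, and the symmetry induced by a cellular homeomorphism. -/

namespace RAPolytope

variable {n : ℕ} {ι : Type*} {P : RAPolytope n ι}

theorem facetsOf_facetFace (i : ι) : P.facetsOf (facetFace i) = {i} := by
  obtain ⟨x, hx, h⟩ := P.irredundant i
  have hxb : x ∈ P.body := fun k => by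
    by_cases hk : k = i
    · rw [hk, hx]
    · exact (h k hk).le
  ext j
  constructor
  · intro hj
    by_contra hji
    exact (h j hji).ne (hj (a := x) ⟨hxb, hx⟩).2
  · rintro rfl
    exact le_rfl (a := facetFace (P := P) j)

variable (P) in
/-- The polytope as a face of itself. -/
def topFace : P.Face :=
  ⟨P.body, P.solid.imp fun _ h i => (h i).le, ∅, by simp⟩

theorem le_topFace (C : P.Face) : C ≤ P.topFace := fun _ hx => ((mem_face_iff C).1 hx).1

theorem eq_topFace_or_le (C : P.Face) : C = P.topFace ∨ ∃ i, C ≤ facetFace i := by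
  rcases (P.facetsOf C).eq_empty_or_nonempty with h | ⟨i, hi⟩
  · refine Or.inl (le_antisymm (le_topFace C) (le_iff_facetsOf.2 ?_))
    rw [h]
    exact Set.empty_subset _
  · exact Or.inr ⟨i, hi⟩

theorem not_topFace_le (i : ι) : ¬P.topFace ≤ facetFace i := fun h => by
  obtain ⟨x, hx⟩ := P.solid
  exact (hx i).ne (h (a := x) fun i => (hx i).le).2

theorem orderIso_topFace (α : P.Face ≃o P.Face) : α P.topFace = P.topFace :=
  le_antisymm (le_topFace _) (α.symm_apply_le.1 (le_topFace _))

/-- Order automorphisms of the face poset map facets to facets. -/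
theorem exists_facet_eq (α : P.Face ≃o P.Face) (i : ι) : ∃ j, α (facetFace i) = facetFace j := by
  have key : ∀ (β : P.Face ≃o P.Face) i, ∃ j, β (facetFace i) ≤ facetFace j := fun β i => by
    refine (eq_topFace_or_le _).resolve_left fun h => not_topFace_le (P := P) i ?_
    rw [← β.le_iff_le, h]
    exact le_topFace _
  obtain ⟨j, hj⟩ := key α i
  obtain ⟨k, hk⟩ := key α.symm j
  have h1 : facetFace i ≤ facetFace (P := P) k := le_trans (by rwa [α.le_symm_apply]) hk
  rw [le_facetFace_iff, facetsOf_facetFace] at h1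
  have h1 : k = i := h1
  subst h1
  exact ⟨j, le_antisymm hj (by rwa [α.symm_apply_le] at hk)⟩

/-- The permutation of the facets induced by an automorphism of the face poset. -/
theorem exists_facet_perm (α : P.Face ≃o P.Face) :
    ∃ σ : Equiv.Perm ι, ∀ i, α (facetFace i) = facetFace (σ i) := by
  choose f hf using exists_facet_eq α
  choose g hg using exists_facet_eq α.symm
  refine ⟨⟨f, g, fun i => ?_, fun i => ?_⟩, hf⟩
  · apply facetFace_injective
    rw [← hg, ← hf, OrderIso.symm_apply_apply]
  · apply facetFace_injective
    rw [← hf, ← hg, OrderIso.apply_symm_apply]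

/-- Incidence is expressed through the face poset, hence preserved by its automorphisms. -/
theorem meets_iff {i j : ι} : P.Meets i j ↔ ∃ C : P.Face, C ≤ facetFace i ∧ C ≤ facetFace j := by
  constructor
  · rintro ⟨x, hi, hj⟩
    refine ⟨minFace ⟨x, hi.1⟩, ?_, ?_⟩ <;> rw [le_facetFace_iff, facetsOf_minFace]
    exacts [hi.2, hj.2]
  · rintro ⟨C, hi, hj⟩
    obtain ⟨x, hx⟩ := C.2.1
    exact ⟨x, hi hx, hj hx⟩

theorem meets_perm_iff {α : P.Face ≃o P.Face} {σ : Equiv.Perm ι}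
    (h : ∀ i, α (facetFace i) = facetFace (σ i)) (i j : ι) :
    P.Meets i j ↔ P.Meets (σ i) (σ j) := by
  rw [meets_iff, meets_iff, ← h, ← h]
  constructor
  · rintro ⟨C, hi, hj⟩
    exact ⟨α C, α.monotone hi, α.monotone hj⟩
  · rintro ⟨C, hi, hj⟩
    exact ⟨α.symm C, α.symm_apply_le.2 hi, α.symm_apply_le.2 hj⟩

theorem eq_one_or_eq_gen {i : ι} {k : P.W} (hk : k ∈ Subgroup.closure {P.gen i}) :
    k = 1 ∨ k = P.gen i := by
  have key : ∀ a : P.W, a = 1 ∨ a = P.gen i → a * P.gen i = 1 ∨ a * P.gen i = P.gen i := by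
    rintro a (rfl | rfl)
    · exact Or.inr (one_mul _)
    · exact Or.inl (P.gen_mul_self i)
  induction hk using Subgroup.closure_induction_right with
  | one => exact Or.inl rfl
  | mul_right a b ha hb ih =>
    rw [Set.mem_singleton_iff.1 hb]
    exact key a ih
  | mul_inv_cancel a b ha hb ih =>
    rw [Set.mem_singleton_iff.1 hb, gen_inv]
    exact key a ih

namespace CharFn

variable (l m : P.CharFn)

/-- The closed cell of the small cover given by a face of a tile. -/
def cell (w : P.W) (C : P.Face) : Set l.SmallCover := l.proj '' ((fun x => w • x) '' C.1)

theorem mem_cells_iff {D : Set l.SmallCover} : D ∈ l.cells ↔ ∃ w C, D = l.cell w C := by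
  constructor
  · rintro ⟨w, hw, C, hC, rfl⟩
    exact ⟨⟨w, hw⟩, ⟨C, hC⟩, rfl⟩
  · rintro ⟨w, C, rfl⟩
    exact ⟨w.1, w.2, C.1, C.2, rfl⟩

theorem cell_mem_cells (w : P.W) (C : P.Face) : l.cell w C ∈ l.cells :=
  l.mem_cells_iff.2 ⟨w, C, rfl⟩

variable {l}

/-- The strict fundamental domain read in the quotient: each tile embeds, and tiles are glued at `x`
only through the local group of `x`. -/
theorem eq_of_proj_eq {v w : P.W} {x y : Hyp n} (hx : x ∈ P.body) (hy : y ∈ P.body)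
    (h : l.proj (v • x) = l.proj (w • y)) :
    x = y ∧ ∃ k ∈ P.localW x, l.hom v = l.hom w * l.hom k := by
  obtain ⟨k, hk, e⟩ := l.proj_eq_iff.1 h
  rw [← mul_smul] at e
  obtain ⟨h1, h2⟩ := P.eq_of_smul_eq_smul (x := ⟨x, hx⟩) (y := ⟨y, hy⟩) e
  refine ⟨congrArg Subtype.val h1, _, h2, ?_⟩
  rw [map_mul, map_inv, map_mul, hk, one_mul, mul_inv_cancel_left]

theorem proj_eq_of_hom_eq {v w k : P.W} {x : Hyp n} (hk : k ∈ P.localW x)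
    (h : l.hom v = l.hom w * l.hom k) : l.proj (v • x) = l.proj (w • x) := by
  refine l.proj_eq_iff.2 ⟨v * (w * k)⁻¹, ?_, ?_⟩
  · rw [map_mul, map_inv, map_mul, h, mul_inv_cancel]
  · rw [← mul_smul]
    have := P.smul_eq_of_mem_localW (inv_mem hk)
    rw [mul_inv_rev, mul_assoc, inv_mul_cancel_right, mul_smul, this]

theorem proj_mem_cell_iff {w : P.W} {C : P.Face} {x : Hyp n} (hx : x ∈ P.body) :
    l.proj (w • x) ∈ l.cell w C ↔ x ∈ C.1 := by
  constructor
  · rintro ⟨_, ⟨y, hy, rfl⟩, h⟩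
    rw [← (eq_of_proj_eq ((mem_face_iff C).1 hy).1 hx h).1]
    exact hy
  · intro h
    exact ⟨_, ⟨x, h, rfl⟩, rfl⟩

theorem cell_subset_iff {w : P.W} {C D : P.Face} : l.cell w C ⊆ l.cell w D ↔ C ≤ D := by
  constructor
  · intro h x hx
    exact (proj_mem_cell_iff ((mem_face_iff C).1 hx).1).1 (h ⟨_, ⟨x, hx, rfl⟩, rfl⟩)
  · intro h
    exact Set.image_mono (Set.image_mono h)

theorem proj_eq_of_cell_subset {v w : P.W} {C D : P.Face} (h : l.cell v C ⊆ l.cell w D)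
    {x : Hyp n} (hx : x ∈ C.1) : x ∈ D.1 ∧ l.proj (v • x) = l.proj (w • x) := by
  obtain ⟨_, ⟨y, hy, rfl⟩, e⟩ := h ⟨_, ⟨x, hx, rfl⟩, rfl⟩
  have := (eq_of_proj_eq ((mem_face_iff D).1 hy).1 ((mem_face_iff C).1 hx).1 e).1
  subst this
  exact ⟨hy, e.symm⟩

theorem le_of_cell_subset {v w : P.W} {C D : P.Face} (h : l.cell v C ⊆ l.cell w D) : C ≤ D :=
  fun _ hx => (proj_eq_of_cell_subset h hx).1

theorem cell_congr {v w : P.W} {C : P.Face} (h : ∀ x ∈ C.1, l.proj (v • x) = l.proj (w • x)) :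
    l.cell v C = l.cell w C := by
  rw [cell, cell, Set.image_image, Set.image_image]
  exact Set.image_congr h

theorem cell_eq_of_subset {v w : P.W} {C D : P.Face} (h : l.cell v C ⊆ l.cell w D) :
    l.cell v C = l.cell w C :=
  cell_congr fun _ hx => (proj_eq_of_cell_subset h hx).2

theorem cell_eq_of_hom_eq {v w : P.W} (h : l.hom v = l.hom w) (C : P.Face) :
    l.cell v C = l.cell w C :=
  cell_congr fun _ _ => proj_eq_of_hom_eq (one_mem _) (by rw [h, map_one, mul_one])

/-- An interior point of a tile has trivial local group, so maximal cells correspond to values of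
`l.hom`. -/
theorem hom_eq_of_cell_subset {v w : P.W} {D : P.Face} (h : l.cell v P.topFace ⊆ l.cell w D) :
    l.hom v = l.hom w := by
  obtain ⟨x, hx⟩ := P.solid
  have hxb : x ∈ P.body := fun i => (hx i).le
  obtain ⟨-, k, hk, e⟩ := eq_of_proj_eq hxb hxb (proj_eq_of_cell_subset h hxb).2
  have hs : P.supp x = ∅ := Set.eq_empty_iff_forall_notMem.2 fun i hi => (hx i).ne hi
  rw [localW, hs, Set.image_empty, Subgroup.closure_empty, Subgroup.mem_bot] at hk
  rw [e, hk, map_one, mul_one]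

theorem hom_eq_iff_cell_eq {v w : P.W} :
    l.hom v = l.hom w ↔ l.cell v P.topFace = l.cell w P.topFace :=
  ⟨fun h => cell_eq_of_hom_eq h _, fun h => hom_eq_of_cell_subset h.le⟩

theorem cell_mul_gen {w : P.W} {i : ι} {C : P.Face} (h : C ≤ facetFace i) :
    l.cell (w * P.gen i) C = l.cell w C :=
  cell_congr fun x hx => by rw [mul_smul, gen_smul, P.s_eq_self (h hx).2]

/-- A relative interior point of facet `i` has local group generated by `gen i` alone, so only the
two tiles on either side contain the facet cell. -/
theorem hom_eq_or_of_facet_subset {v w : P.W} {i : ι} {D : P.Face}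
    (h : l.cell v (facetFace i) ⊆ l.cell w D) :
    l.hom v = l.hom w ∨ l.hom v = l.hom (w * P.gen i) := by
  obtain ⟨x, hx, hne⟩ := P.irredundant i
  have hxb : x ∈ P.body := fun k => by
    by_cases hk : k = i
    · rw [hk, hx]
    · exact (hne k hk).le
  obtain ⟨-, k, hk, e⟩ := eq_of_proj_eq hxb hxb
    (proj_eq_of_cell_subset (x := x) h ⟨hxb, hx⟩).2
  have hs : P.supp x ⊆ {i} := fun j hj => by
    by_contra hji
    exact (hne j hji).ne hj
  have hk2 : k = 1 ∨ k = P.gen i :=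
    eq_one_or_eq_gen (Subgroup.closure_mono
      ((Set.image_mono hs).trans (by rw [Set.image_singleton])) hk)
  rcases hk2 with rfl | rfl
  · exact Or.inl (by rw [e, map_one, mul_one])
  · exact Or.inr (by rw [e, map_mul])

variable {m}

theorem IsCellIso.symm {φ : l.SmallCover ≃ₜ m.SmallCover} (h : IsCellIso φ) :
    IsCellIso φ.symm := fun D => by
  rw [h, ← Set.image_comp, Homeomorph.self_comp_symm, Set.image_id]

/-- Tiles are the maximal cells: enclose the image in a tile and pull this back to a cell containing
the original tile. -/
theorem IsCellIso.exists_tile {φ : l.SmallCover ≃ₜ m.SmallCover} (h : IsCellIso φ) (w : P.W) :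
    ∃ v, φ '' l.cell w P.topFace = m.cell v P.topFace := by
  obtain ⟨v, C, hC⟩ := m.mem_cells_iff.1 ((h _).1 (l.cell_mem_cells w P.topFace))
  obtain ⟨u, D, hD⟩ := l.mem_cells_iff.1 ((h.symm _).1 (m.cell_mem_cells v P.topFace))
  have hD' : m.cell v P.topFace = φ '' l.cell u D := by
    rw [← hD, ← Set.image_comp, Homeomorph.self_comp_symm, Set.image_id]
  have h1 : φ '' l.cell w P.topFace ⊆ φ '' l.cell u D := by
    rw [hC, ← hD']
    exact cell_subset_iff.2 (le_topFace C)
  have h2 := (Set.image_subset_image_iff φ.injective).1 h1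
  have h3 : D = P.topFace := le_antisymm (le_topFace D) (le_of_cell_subset h2)
  refine ⟨v, ?_⟩
  rw [hD', h3, cell_eq_of_hom_eq (hom_eq_of_cell_subset h2)]

theorem IsCellIso.exists_face {φ : l.SmallCover ≃ₜ m.SmallCover} (h : IsCellIso φ) {w v : P.W}
    (hv : φ '' l.cell w P.topFace = m.cell v P.topFace) (C : P.Face) :
    ∃ D, φ '' l.cell w C = m.cell v D := by
  obtain ⟨u, D, hD⟩ := m.mem_cells_iff.1 ((h _).1 (l.cell_mem_cells w C))
  refine ⟨D, hD.trans (cell_eq_of_subset (D := P.topFace) ?_)⟩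
  rw [← hD, ← hv]
  exact Set.image_mono (cell_subset_iff.2 (le_topFace C))

/-- A cellular homeomorphism induces an isomorphism between the face posets of a tile and of its
image. -/
theorem IsCellIso.exists_orderIso {φ : l.SmallCover ≃ₜ m.SmallCover} (h : IsCellIso φ) {w v : P.W}
    (hv : φ '' l.cell w P.topFace = m.cell v P.topFace) :
    ∃ α : P.Face ≃o P.Face, ∀ C, φ '' l.cell w C = m.cell v (α C) := by
  choose f hf using h.exists_face hv
  have hv' : φ.symm '' m.cell v P.topFace = l.cell w P.topFace := by
    rw [← hv, ← Set.image_comp, Homeomorph.symm_comp_self, Set.image_id]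
  have hle : ∀ C D, f C ≤ f D ↔ C ≤ D := fun C D => by
    rw [← cell_subset_iff (l := m) (w := v), ← hf, ← hf, Set.image_subset_image_iff φ.injective,
      cell_subset_iff]
  have hsurj : Function.Surjective (OrderEmbedding.ofMapLEIff f hle) := fun D => by
    obtain ⟨C, hC⟩ := h.symm.exists_face hv' D
    have h1 : m.cell v (f C) = m.cell v D := by
      rw [← hf, ← hC, ← Set.image_comp, Homeomorph.self_comp_symm, Set.image_id]
    exact ⟨C, le_antisymm (cell_subset_iff.1 h1.le) (cell_subset_iff.1 h1.ge)⟩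
  exact ⟨RelIso.ofSurjective _ hsurj, hf⟩

/-- A cellular homeomorphism of small covers is induced by a symmetry of the polytope. -/
theorem IsCellIso.exists_symmetry {φ : l.SmallCover ≃ₜ m.SmallCover} (h : IsCellIso φ) :
    ∃ (α : P.Face ≃o P.Face) (σ : Equiv.Perm ι) (a : P.W ≃* P.W) (v : P.W),
      (∀ i, α (facetFace i) = facetFace (σ i)) ∧ (∀ i, a (P.gen i) = P.gen (σ i)) ∧
      (∀ w, l.hom w = 1 ↔ m.hom (a w) = 1) ∧ ∀ C, φ '' l.cell 1 C = m.cell v (α C) := by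
  choose θ hθ using h.exists_tile
  choose α hα using fun w => h.exists_orderIso (hθ w)
  choose σ hσ using fun w => exists_facet_perm (α w)
  have hcell : ∀ w i C, C ≤ facetFace i →
      m.cell (θ (w * P.gen i)) (α (w * P.gen i) C) = m.cell (θ w) (α w C) := fun w i C hC => by
    rw [← hα, ← hα, cell_mul_gen hC]
  have hαC : ∀ w i C, C ≤ facetFace i → α (w * P.gen i) C = α w C := fun w i C hC =>
    le_antisymm (le_of_cell_subset (hcell w i C hC).le) (le_of_cell_subset (hcell w i C hC).ge)
  -- The automorphisms of adjacent tiles agree below the common facet, so rigidity identifies their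
  -- facet permutations.
  have hσs : ∀ w i, σ (w * P.gen i) = σ w := fun w i => by
    ext j
    have h1 := automorphism_rigid ((α (w * P.gen i)).trans (α w).symm)
      (fun j => (σ w).symm (σ (w * P.gen i) j)) (fun j => by
        rw [OrderIso.trans_apply, hσ, OrderIso.symm_apply_eq, hσ, Equiv.apply_symm_apply])
      (i := i) (fun C hC => by
        rw [OrderIso.trans_apply, hαC w i C hC, OrderIso.symm_apply_apply]) j
    exact (Equiv.symm_apply_eq _).1 h1
  have hσ1 : ∀ w, σ w = σ 1 := fun w => by
    induction w using P.W_induction with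
    | one => rfl
    | mul w i ih => rw [hσs, ih]
  obtain ⟨a, ha⟩ := P.exists_mulEquiv (σ 1) (meets_perm_iff (hσ 1))
  have hθeq : ∀ w w', l.hom w = l.hom w' ↔ m.hom (θ w) = m.hom (θ w') := fun w w' => by
    rw [hom_eq_iff_cell_eq, hom_eq_iff_cell_eq, ← hθ, ← hθ, φ.injective.image_injective.eq_iff]
  have hstep : ∀ w i, m.hom (θ (w * P.gen i)) = m.hom (θ w * P.gen (σ 1 i)) := fun w i => by
    have h1 : m.cell (θ (w * P.gen i)) (facetFace (σ 1 i)) =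
        m.cell (θ w) (facetFace (σ 1 i)) := by
      have := hcell w i _ le_rfl
      rwa [hσ, hσ, hσ1, hσ1 w] at this
    -- Pull back the tile across the image facet. Its preimage `u` contains facet `i` of tile `w`,
    -- so modulo the kernel it is `w` or `w * gen i`.
    obtain ⟨u, hu⟩ := h.symm.exists_tile (θ w * P.gen (σ 1 i))
    have hu' : m.hom (θ u) = m.hom (θ w * P.gen (σ 1 i)) := by
      rw [hom_eq_iff_cell_eq, ← hθ, ← hu, ← Set.image_comp, Homeomorph.self_comp_symm, Set.image_id]
    have h2 : l.cell w (facetFace i) ⊆ l.cell u P.topFace := by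
      rw [← Set.image_subset_image_iff φ.injective, hα, hθ, hσ, hσ1 w,
        cell_eq_of_hom_eq hu', ← cell_mul_gen (w := θ w) le_rfl]
      exact cell_subset_iff.2 (le_topFace _)
    rcases hom_eq_or_of_facet_subset h2 with h3 | h3
    -- If it is `w`, then `m.hom` kills the generator, and both candidates for the image of `w * gen
    -- i` coincide.
    · have h4 := (hθeq w u).1 h3
      rw [hu', map_mul, left_eq_mul] at h4
      rcases hom_eq_or_of_facet_subset (h1.le.trans (cell_subset_iff.2 (le_topFace _))) with h5 | h5
      · rw [h5, map_mul, h4, mul_one]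
      · exact h5
    · rw [← hu', ← hθeq]
      rw [map_mul, h3, map_mul, mul_assoc, ← map_mul l.hom (P.gen i), P.gen_mul_self, map_one,
        mul_one]
  have hθa : ∀ w, m.hom (θ w) = m.hom (θ 1) * m.hom (a w) := fun w => by
    induction w using P.W_induction with
    | one => rw [map_one, map_one, mul_one]
    | mul w i ih => rw [hstep, map_mul, ih, map_mul, map_mul, ha, mul_assoc]
  refine ⟨α 1, σ 1, a, θ 1, hσ 1, ha, fun w => ?_, hα 1⟩
  have := hθeq w 1
  rwa [map_one, hθa w, mul_eq_left] at this

end CharFn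

end RAPolytope

/-- Epimorphisms with the same kernel factor through each other, and additive maps between vector
spaces over `ZMod 2` are linear. -/
theorem exists_generalLinear_of_ker_eq {G : Type*} [Group G] {n : ℕ}
    {f g : G →* Multiplicative (Fin n → ZMod 2)} (hf : Function.Surjective f)
    (hg : Function.Surjective g) (h : ∀ w, f w = 1 ↔ g w = 1) :
    ∃ A : Matrix.GeneralLinearGroup (Fin n) (ZMod 2),
      ∀ w, (f w).toAdd = A.1.mulVec (g w).toAdd := by
  have key : ∀ {f g : G →* Multiplicative (Fin n → ZMod 2)} (_ : Function.Surjective g)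
      (_ : ∀ w, g w = 1 → f w = 1), ∃ L : (Fin n → ZMod 2) →ₗ[ZMod 2] (Fin n → ZMod 2),
      ∀ w, (f w).toAdd = L (g w).toAdd := by
    intro f g hg h
    let e := g.liftOfSurjective hg ⟨f, h⟩
    let e' : (Fin n → ZMod 2) →+ (Fin n → ZMod 2) := AddMonoidHom.toMultiplicative.symm e
    refine ⟨e'.toZModLinearMap 2, fun w => ?_⟩
    have : e (g w) = f w := g.liftOfRightInverse_comp_apply _ _ ⟨f, h⟩ w
    rw [← this]
    rfl
  obtain ⟨L, hL⟩ := key hg fun w => (h w).2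
  obtain ⟨L', hL'⟩ := key hf fun w => (h w).1
  have h1 : L ∘ₗ L' = LinearMap.id := LinearMap.ext fun v => by
    obtain ⟨w, hw⟩ := hf (Multiplicative.ofAdd v)
    have hw' : (f w).toAdd = v := by rw [hw]; rfl
    rw [LinearMap.comp_apply, ← hw', ← hL', ← hL]
    rfl
  have h2 : L' ∘ₗ L = LinearMap.id := LinearMap.ext fun v => by
    obtain ⟨w, hw⟩ := hg (Multiplicative.ofAdd v)
    have hw' : (g w).toAdd = v := by rw [hw]; rfl
    rw [LinearMap.comp_apply, ← hw', ← hL, ← hL']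
    rfl
  refine ⟨⟨LinearMap.toMatrix' L, LinearMap.toMatrix' L', ?_, ?_⟩, fun w => ?_⟩
  · rw [← LinearMap.toMatrix'_comp, h1, LinearMap.toMatrix'_id]
  · rw [← LinearMap.toMatrix'_comp, h2, LinearMap.toMatrix'_id]
  · rw [hL, LinearMap.toMatrix'_mulVec]

/-! ### Equivalence versus isomorphism, combinatorial and geometric. -/

namespace RAPolytope

variable {n : ℕ} {ι : Type*} {P : RAPolytope n ι}

/-- The interior of the polytope is connected. -/
theorem isPreconnected_interior : IsPreconnected {x : Hyp n | ∀ i, lor x.1 (P.normal i) < 0} := by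
  -- The open cone over the interior is convex, and normalization maps it continuously onto the
  -- interior.
  have hconv : Convex ℝ {v : LVec n | ‖v.2‖ < v.1 ∧ ∀ i, lor v (P.normal i) < 0} := by
    have : {v : LVec n | ‖v.2‖ < v.1 ∧ ∀ i, lor v (P.normal i) < 0} =
        {v : LVec n | ‖v.2‖ < v.1} ∩ ⋂ i, {v | lorLin (P.normal i) v < 0} := by
      ext v
      simp [lorLin]
    rw [this]
    exact convex_future.inter (convex_iInter fun i =>
      convex_halfSpace_lt (lorLin (P.normal i)).isLinear 0)
  have := Subtype.preconnectedSpace hconv.isPreconnected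
  let N : {v : LVec n | ‖v.2‖ < v.1 ∧ ∀ i, lor v (P.normal i) < 0} → Hyp n := fun v =>
    hypNormalize v.1 (lor_neg_of_norm_lt v.2.1) ((norm_nonneg _).trans_lt v.2.1)
  have hN : Continuous N := by
    refine continuous_induced_rng.2 (Continuous.fun_smul ?_ continuous_subtype_val)
    refine Continuous.inv₀ (Continuous.sqrt
      (continuous_subtype_val.lor continuous_subtype_val).neg) fun v => ?_
    have := lor_neg_of_norm_lt v.2.1
    exact (Real.sqrt_pos.2 (by linarith)).ne'
  convert isPreconnected_range hN
  ext x
  constructor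
  · intro hx
    refine ⟨⟨x.1, x.norm_lt, hx⟩, ?_⟩
    obtain ⟨c, -, h⟩ := hypNormalize_eq x.1 (lor_neg_of_norm_lt x.norm_lt)
      ((norm_nonneg _).trans_lt x.norm_lt)
    exact Hyp.eq_of_smul_eq h
  · rintro ⟨v, rfl⟩ i
    obtain ⟨c, hc, h⟩ := hypNormalize_eq v.1 (lor_neg_of_norm_lt v.2.1)
      ((norm_nonneg _).trans_lt v.2.1)
    change lor (hypNormalize _ _ _).1 _ < 0
    rw [h, lor_smul_left]
    exact mul_neg_of_pos_of_neg hc (v.2.2 i)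

/-- The polytope is the closure of its interior. -/
theorem body_subset_closure : P.body ⊆ closure {x : Hyp n | ∀ i, lor x.1 (P.normal i) < 0} := by
  intro x hx
  obtain ⟨x₀, hx₀⟩ := P.solid
  let s : ℕ → ℝ := fun k => 1 / ((k : ℝ) + 1)
  have hs : ∀ k, 0 < s k := fun k => Nat.one_div_pos_of_nat
  have hv : ∀ k, ‖(x.1 + s k • x₀.1).2‖ < (x.1 + s k • x₀.1).1 := fun k => by
    have := norm_lt_sum_smul Finset.univ ![1, s k] ![x, x₀]
      (by intro a _; fin_cases a <;> simp [(hs k).le]) (by simp; linarith [hs k])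
    simpa using this
  let y : ℕ → Hyp n := fun k =>
    hypNormalize _ (lor_neg_of_norm_lt (hv k)) ((norm_nonneg _).trans_lt (hv k))
  refine mem_closure_of_tendsto (f := y) (b := atTop) ?_ (Eventually.of_forall fun k i => ?_)
  · apply Hyp.tendsto_of_lor
    let F : ℝ → ℝ := fun t =>
      (√(-lor (x.1 + t • x₀.1) (x.1 + t • x₀.1)))⁻¹ * lor x.1 (x.1 + t • x₀.1)
    have hF0 : F 0 = -1 := by simp [F, x.lor_self]
    have hF : ContinuousAt F 0 := by
      refine ContinuousAt.mul (ContinuousAt.inv₀ (Continuous.continuousAt ?_) ?_)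
        (Continuous.continuousAt ?_)
      · fun_prop
      · simp [x.lor_self]
      · fun_prop
    have h1 := hF.tendsto.comp (tendsto_one_div_add_atTop_nhds_zero_nat (𝕜 := ℝ))
    rw [hF0] at h1
    refine h1.congr fun k => ?_
    change _ = lor x.1 (_ • _)
    rw [lor_smul_right]
    rfl
  · change lor (_ • _) _ < 0
    rw [lor_smul_left]
    have h2 := lor_neg_of_norm_lt (hv k)
    refine mul_neg_of_pos_of_neg (inv_pos.2 (Real.sqrt_pos.2 (by linarith))) ?_
    rw [lor_add_left, lor_smul_left]
    have := mul_neg_of_pos_of_neg (hs k) (hx₀ i)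
    linarith [hx i]

namespace CharFn

variable {l m : P.CharFn}

/-- Trades the matrix for a condition on kernels, the form in which both constructions use it. -/
theorem equivalentVia_iff {A : Set (Equiv.Perm ι)} : EquivalentVia A l m ↔
    ∃ σ ∈ A, ∃ a : P.W ≃* P.W, (∀ i, a (P.gen i) = P.gen (σ i)) ∧
      ∀ w, l.hom w = 1 ↔ m.hom (a w) = 1 := by
  refine exists_congr fun σ => and_congr_right fun _ => exists_congr fun a =>
    and_congr_right fun _ => ⟨?_, fun h => ?_⟩
  · rintro ⟨g, hg⟩ w
    have h1 : l.hom w = 1 ↔ (l.hom w).toAdd = 0 := Iff.rfl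
    have h2 : m.hom (a w) = 1 ↔ (m.hom (a w)).toAdd = 0 := Iff.rfl
    rw [h1, h2, hg]
    constructor
    · intro h
      have := congrArg (g⁻¹.1.mulVec) h
      rwa [Matrix.mulVec_mulVec, Matrix.mulVec_zero, ← Units.val_mul, inv_mul_cancel, Units.val_one,
        Matrix.one_mulVec] at this
    · intro h
      rw [h, Matrix.mulVec_zero]
  · exact exists_generalLinear_of_ker_eq (g := m.hom.comp a.toMonoidHom) l.surj
      (m.surj.comp a.surjective) h

theorem exists_cellIso_of_comb (h : EquivalentVia P.combSymmetries l m) :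
    ∃ φ : l.SmallCover ≃ₜ m.SmallCover, IsCellIso φ := by
  obtain ⟨σ, ⟨α, hα⟩, a, ha, hk⟩ := equivalentVia_iff.1 h
  obtain ⟨f, hf⟩ := exists_homeomorph α σ fun i => Subtype.ext (hα i (facetFace i) rfl)
  obtain ⟨φ, hφ, -⟩ := exists_cellIso f a σ ha hf hk
  exact ⟨φ, hφ⟩

theorem exists_cellIso_of_isom (h : EquivalentVia P.isomSymmetries l m) :
    ∃ φ : l.SmallCover ≃ₜ m.SmallCover, IsCellIso φ ∧ IsCellwiseIsometric φ := by
  obtain ⟨σ, ⟨h, hh, hP, hF⟩, a, ha, hk⟩ := equivalentVia_iff.1 h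
  have hmem : ∀ x, x ∈ P.body ↔ h x ∈ P.body := fun x => by
    conv_rhs => rw [← hP, h.injective.mem_set_image]
  let f : P.body ≃ₜ P.body :=
    { toFun := fun x => ⟨h x.1, (hmem _).1 x.2⟩
      invFun := fun x => ⟨h⁻¹ x.1, (hmem _).2 (by simp)⟩
      left_inv := fun x => Subtype.ext (by simp)
      right_inv := fun x => Subtype.ext (by simp)
      continuous_toFun := (hh.continuous.comp continuous_subtype_val).subtype_mk _
      continuous_invFun := (hh.symm.continuous.comp continuous_subtype_val).subtype_mk _ }
  have hf : ∀ (x : P.body) i, i ∈ P.supp x.1 ↔ σ i ∈ P.supp (f x).1 := fun x i => by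
    have h1 : x.1 ∈ P.facet i ↔ h x.1 ∈ P.facet (σ i) := by
      rw [← hF, h.injective.mem_set_image]
    rw [mem_facet_iff, mem_facet_iff] at h1
    exact ⟨fun h2 => (h1.1 ⟨x.2, h2⟩).2, fun h2 => (h1.2 ⟨(f x).2, h2⟩).2⟩
  obtain ⟨φ, hφ, hφ'⟩ := exists_cellIso f a σ ha hf hk
  -- Return to the base tile, apply the symmetry, and move to the image tile.
  refine ⟨φ, hφ, fun w hw => ⟨(a ⟨w, hw⟩).1 * h * w⁻¹, ?_, ?_⟩⟩
  · exact ((P.isHypIsometry_W _).mul hh).mul (P.isHypIsometry_W ⟨w, hw⟩).symm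
  · rintro _ ⟨x, hx, rfl⟩
    refine (hφ' ⟨w, hw⟩ ⟨x, hx⟩).trans ?_
    have hwx : w⁻¹ (w x) = x := by simp
    rw [Equiv.Perm.mul_apply, Equiv.Perm.mul_apply, hwx]
    rfl

theorem IsCellIso.equivalentVia_comb {φ : l.SmallCover ≃ₜ m.SmallCover} (h : IsCellIso φ) :
    EquivalentVia P.combSymmetries l m := by
  obtain ⟨α, σ, a, v, hα, ha, hk, -⟩ := h.exists_symmetry
  refine equivalentVia_iff.2 ⟨σ, ⟨α, fun i C hC => ?_⟩, a, ha, hk⟩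
  have : C = facetFace i := Subtype.ext hC
  rw [this, hα]
  rfl

/-- The isometry on the base tile lifts `φ` only up to the kernel of `m`. Corrected so that one
interior point lands in `P`, it must preserve `P` by connectedness, and it then induces the `σ`
already found. -/
theorem IsCellIso.equivalentVia_isom {φ : l.SmallCover ≃ₜ m.SmallCover} (hφ : IsCellIso φ)
    (hi : IsCellwiseIsometric φ) : EquivalentVia P.isomSymmetries l m := by
  obtain ⟨α, σ, a, v, hα, ha, hk, hcell⟩ := hφ.exists_symmetry
  obtain ⟨h₀, hh₀, hφh₀⟩ := hi 1 (one_mem _)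
  have hφh₀ : ∀ x ∈ P.body, φ (l.proj x) = m.proj (h₀ x) := fun x hx => hφh₀ x ⟨x, hx, rfl⟩
  have hlcell : ∀ {x : Hyp n} {C : P.Face}, x ∈ P.body → (l.proj x ∈ l.cell 1 C ↔ x ∈ C.1) :=
    fun hx => by rw [← proj_mem_cell_iff (l := l) (w := 1) hx, one_smul]
  obtain ⟨x₀, hx₀⟩ := P.solid
  have hx₀b : x₀ ∈ P.body := fun i => (hx₀ i).le
  obtain ⟨k, hk1, hy₀⟩ : ∃ k : P.W, m.hom k = 1 ∧ ∃ y ∈ P.body, h₀ x₀ = k • v • y := by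
    have h1 : φ (l.proj x₀) ∈ m.cell v (α P.topFace) := by
      rw [← hcell]
      exact ⟨_, (hlcell hx₀b).2 hx₀b, rfl⟩
    rw [hφh₀ x₀ hx₀b] at h1
    obtain ⟨_, ⟨y, hy, rfl⟩, e⟩ := h1
    obtain ⟨k, hk, e'⟩ := m.proj_eq_iff.1 e.symm
    exact ⟨k, hk, y, ((mem_face_iff _).1 hy).1, e'⟩
  set h : Equiv.Perm (Hyp n) := ((k * v)⁻¹ : P.W).1 * h₀ with hh
  have hh' : IsHypIsometry h := (P.isHypIsometry_W _).mul hh₀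
  have hh₀h : ∀ x, h₀ x = k • v • h x := fun x => by
    rw [← mul_smul]
    exact (smul_inv_smul (k * v) (h₀ x)).symm
  have hφh : ∀ x ∈ P.body, φ (l.proj x) = m.proj (v • h x) := fun x hx => by
    rw [hφh₀ x hx]
    exact m.proj_eq_iff.2 ⟨k, hk1, hh₀h x⟩
  have hC : ∀ x ∈ P.body, h x ∈ P.body → ∀ C : P.Face, x ∈ C.1 ↔ h x ∈ (α C).1 := by
    intro x hx hhx C
    rw [← hlcell hx, ← proj_mem_cell_iff (l := m) (w := v) hhx, ← hcell, ← hφh x hx,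
      φ.injective.mem_set_image]
  have hint : ∀ x : Hyp n, (∀ i, lor x.1 (P.normal i) < 0) → h x ∈ P.body →
      ∀ i, lor (h x).1 (P.normal i) < 0 := by
    intro x hx hhx i
    refine lt_of_le_of_ne (hhx i) fun h0 => ?_
    have h1 := (hC x (fun i => (hx i).le) hhx (facetFace (σ.symm i))).2 (by
      rw [hα, Equiv.apply_symm_apply]
      exact ⟨hhx, h0⟩)
    exact (hx _).ne h1.2
  have hopen : IsOpen {x : Hyp n | ∀ i, lor x.1 (P.normal i) < 0} := by
    have := P.finite_facets
    simp only [Set.ofPred_forall]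
    exact isOpen_iInter_of_finite fun i => isOpen_lt (by fun_prop) continuous_const
  have hle : {x : Hyp n | ∀ i, lor x.1 (P.normal i) < 0} ⊆ P.body := by
    intro y hy i
    exact (hy i).le
  -- By `hint` no interior point is sent to the boundary, so the interior is covered by two disjoint
  -- open sets: points sent into the interior, and points sent outside `P`. The point `x₀` lies in
  -- the first.
  have hsub : {x : Hyp n | ∀ i, lor x.1 (P.normal i) < 0} ⊆
      h ⁻¹' {x : Hyp n | ∀ i, lor x.1 (P.normal i) < 0} := by
    refine isPreconnected_interior.subset_left_of_subset_union
      (hopen.preimage hh'.continuous)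
      ((P.isCompact_body.isClosed.isOpen_compl).preimage hh'.continuous) ?_ ?_ ?_
    · rw [Set.disjoint_left]
      exact fun x hx hx' => hx' (hle hx)
    · intro x hx
      by_cases hhx : h x ∈ P.body
      · exact Or.inl (hint x hx hhx)
      · exact Or.inr hhx
    · refine ⟨x₀, hx₀, hint x₀ hx₀ ?_⟩
      obtain ⟨y, hy, e⟩ := hy₀
      rw [hh₀h, smul_left_cancel_iff, smul_left_cancel_iff] at e
      rwa [e]
  have hbody : ∀ x ∈ P.body, h x ∈ P.body := by
    intro x hx
    have h1 := map_mem_closure hh'.continuous (body_subset_closure hx) hsub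
    exact closure_minimal hle P.isCompact_body.isClosed h1
  have himage : ∀ C : P.Face, h '' C.1 = (α C).1 := by
    intro C
    apply Set.Subset.antisymm
    · rintro _ ⟨x, hx, rfl⟩
      have hxb := ((mem_face_iff C).1 hx).1
      exact (hC x hxb (hbody x hxb) C).1 hx
    · intro y hy
      have hyb := ((mem_face_iff _).1 hy).1
      have h1 := (proj_mem_cell_iff (l := m) (w := v) hyb).2 hy
      rw [← hcell] at h1
      obtain ⟨_, ⟨_, ⟨x, hx, rfl⟩, rfl⟩, e⟩ := h1
      have hxb := ((mem_face_iff C).1 hx).1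
      simp only [one_smul] at e
      rw [hφh x hxb] at e
      exact ⟨x, hx, (eq_of_proj_eq (hbody x hxb) hyb e).1⟩
  refine equivalentVia_iff.2 ⟨σ, ⟨h, hh', ?_, fun i => ?_⟩, a, ha, hk⟩
  · have := himage P.topFace
    rwa [orderIso_topFace] at this
  · have := himage (facetFace i)
    rwa [hα] at this

end CharFn

end RAPolytope

theorem proposition2p4 {n : ℕ} {ι : Type*} (P : RAPolytope n ι) (l m : P.CharFn) :
    (RAPolytope.CharFn.EquivalentVia P.combSymmetries l m ↔
      ∃ φ : l.SmallCover ≃ₜ m.SmallCover, RAPolytope.CharFn.IsCellIso φ) ∧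
    (RAPolytope.CharFn.EquivalentVia P.isomSymmetries l m ↔
      ∃ φ : l.SmallCover ≃ₜ m.SmallCover,
        RAPolytope.CharFn.IsCellIso φ ∧ RAPolytope.CharFn.IsCellwiseIsometric φ) :=
  ⟨⟨RAPolytope.CharFn.exists_cellIso_of_comb, fun ⟨_, h⟩ => h.equivalentVia_comb⟩,
    RAPolytope.CharFn.exists_cellIso_of_isom, fun ⟨_, h, hi⟩ => h.equivalentVia_isom hi⟩
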